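/- Let $X$ be a complex Banach space. Operators on $X$ are linear, possibly unbounded, and not assumed to be densely defined; $\varrho(A)$ is the set of $\lambda\in\mathbb{C}$ for which $\lambda-A$ has a bounded, everywhere defined inverse $R(\lambda,A)$, $\sigma(A)=\mathbb{C}\setminus\varrho(A)$, and $\mathbb{R}_+=[0,\infty)$. A cosine function is a strongly continuous map $C:\mathbb{R}\to\mathcal{L}(X)$ with $C(0)=I$ and $C(t+s)+C(t-s)=2C(t)C(s)$ for all $t,s\in\mathbb{R}$; its generator is the operator $G$ with $\lambda^2\in\varrho(G)$ and $\lambda R(\lambda^2,G)x=\int_0^\infty e^{-\lambda t}C(t)x\,dt$ for all $x\in X$ and all real $\lambda$ larger than the exponential growth bound of $C$. Let $S_\omega=\{z\neq0: |\arg z|<\omega\}$ for $\omega\in(0,\pi]$ and $S_0=(0,\infty)$; let $H_\omega=\{z:|\operatorname{Im}z|<\omega\}$ for $\omega>0$ and $H_0=\mathbb{R}$. An operator $A$ is sectorial of angle $\omega\in[0,\pi)$ if $\sigma(A)\subset\overline{S_\omega}$ and $\sup\{\|\lambda R(\lambda,A)\|:\lambda\notin\overline{S_{\omega'}}\}<\infty$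 for every $\omega'\in(\omega,\pi)$. It is strip-type of height $\omega\ge0$ if $\sigma(A)\subset\overline{H_\omega}$ and $\sup\{\|R(\lambda,A)\|:|\operatorname{Im}\lambda|\ge\omega'\}<\infty$ for every $\omega'>\omega$, and strong strip-type of height $\omega$ if, in addition, for every $\omega'>\omega$ there is $L$ with $\|R(\lambda,A)\|\le L/(|\operatorname{Im}\lambda|-\omega')$ whenever $|\operatorname{Im}\lambda|>\omega'$. For $A$ sectorial of angle $\omega$, the square root $A^{1/2}$ is the operator given by the sectorial functional calculus, $$A^{1/2}=(1+A)\,T,\qquad T=\frac1{2\pi i}\int_{\partial S_\delta}\frac{z^{1/2}}{1+z}\,R(z,A)\,dz,\qquad \delta\in(\omega,\pi),$$ with the domain $\{x: Tx\in\mathscr{D}(A)\}$, where $\partial S_\delta$ is positively oriented and $z^{1/2}$ is the principal branch; it does not depend on $\delta$. (a) Let $M\ge1$ and let $-A$ be the generator of a cosine function $C$ on $X$ with $\|C(t)\|\le M$ for all $t\in\mathbb{R}$. Then $\sigma(A)\subset\mathbb{R}_+$ and $$\lambda^2\in\varrho(A),\qquad \|R(\lambda^2,A)\|\le\frac{M}{|\lambda|\,|\operatorname{Im}\lambda|}\qquad(\lambda\in\mathbb{C}\setminus\mathbb{R}).\tag{1}$$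 (b) Let $A$ be any operator on $X$ that satisfies (1) for some constant $M$. Then $A$ is sectorial of angle $0$, the operator $A^{1/2}$ is well defined (the choice of $\delta\in(0,\pi)$ does not matter), and $A^{1/2}$ is both sectorial of angle $0$ and strong strip-type of height $0$. More precisely, there is $\tilde M\ge0$ such that every $\lambda\in\mathbb{C}\setminus\mathbb{R}$ belongs to $\varrho(A^{1/2})$ and $$\|R(\lambda,A^{1/2})\|\le\frac{\tilde M}{|\operatorname{Im}\lambda|}.$$ -/

import Mathlib

noncomputable section

namespace CosineSqrt

variable {X : Type*} [NormedAddCommGroup X] [NormedSpace ℂ X]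

/-! ### Resolvent and spectrum of an unbounded operator -/

/-- `R` is a bounded, everywhere defined, two-sided inverse of `z - A : D(A) → X`. -/
def IsResolventAt (A : X →ₗ.[ℂ] X) (z : ℂ) (R : X →L[ℂ] X) : Prop :=
  (∀ x : X, ∃ h : R x ∈ A.domain, z • R x - A ⟨R x, h⟩ = x) ∧
    ∀ y : A.domain, R (z • (y : X) - A y) = y

theorem IsResolventAt.unique {A : X →ₗ.[ℂ] X} {z : ℂ} {R S : X →L[ℂ] X}
    (hR : IsResolventAt A z R) (hS : IsResolventAt A z S) : R = S := by
  ext x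
  obtain ⟨h, hx⟩ := hS.1 x
  have := hR.2 ⟨S x, h⟩
  rwa [hx] at this

/-- The resolvent set `ϱ(A)`. -/
def resolventSet (A : X →ₗ.[ℂ] X) : Set ℂ := {z | ∃ R : X →L[ℂ] X, IsResolventAt A z R}

/-- The spectrum `σ(A)`. -/
def spectrum (A : X →ₗ.[ℂ] X) : Set ℂ := (resolventSet A)ᶜ

open Classical in
/-- The resolvent `R(z, A) = (z - A)⁻¹` for `z ∈ ϱ(A)` (and the dummy value `0` elsewhere). -/
def resolvent (A : X →ₗ.[ℂ] X) (z : ℂ) : X →L[ℂ] X :=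
  if h : ∃ R : X →L[ℂ] X, IsResolventAt A z R then h.choose else 0

theorem resolvent_eq {A : X →ₗ.[ℂ] X} {z : ℂ} {R : X →L[ℂ] X} (hR : IsResolventAt A z R) :
    resolvent A z = R := by
  have h : ∃ R : X →L[ℂ] X, IsResolventAt A z R := ⟨R, hR⟩
  rw [resolvent, dif_pos h]
  exact h.choose_spec.unique hR

/-! ### Cosine functions and their generators -/

/-- Strongly continuous cosine functions on `X`. -/
structure IsCosineFunction (C : ℝ → X →L[ℂ] X) : Prop where
  zero : C 0 = ContinuousLinearMap.id ℂ X
  add_add_sub : ∀ t s : ℝ, C (t + s) + C (t - s) = (2 : ℂ) • (C t ∘L C s)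
  continuous : ∀ x : X, Continuous fun t : ℝ => C t x

/-- The exponential growth bound `θ(C)`. -/
def growthBound (C : ℝ → X →L[ℂ] X) : ℝ :=
  sInf {w : ℝ | 0 ≤ w ∧ ∃ M : ℝ, 1 ≤ M ∧ ∀ t : ℝ, ‖C t‖ ≤ M * Real.exp (w * |t|)}

/-- `G` is the generator of the cosine function `C`: for every real `l > θ(C)` one has
`l² ∈ ϱ(G)` and `l R(l², G) x = ∫₀^∞ e^{-l t} C(t) x dt` for all `x`. -/
def IsGenerator (C : ℝ → X →L[ℂ] X) (G : X →ₗ.[ℂ] X) : Prop :=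
  ∀ l : ℝ, growthBound C < l →
    ((l : ℂ) ^ 2) ∈ resolventSet G ∧
      ∀ x : X, (l : ℂ) • resolvent G ((l : ℂ) ^ 2) x
        = ∫ t in Set.Ioi (0 : ℝ), Complex.exp (-((l : ℂ) * (t : ℂ))) • C t x

/-! ### Sectorial and strip-type operators -/

/-- The open sector `S_w` of half-angle `w` about the positive real axis; `S_0 = (0, ∞)`. -/
def sector (w : ℝ) : Set ℂ :=
  if w = 0 then {z | ∃ t : ℝ, 0 < t ∧ z = t} else {z | z ≠ 0 ∧ |Complex.arg z| < w}

/-- The open horizontal strip `H_w` of height `w` about the real axis; `H_0 = ℝ`. -/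
def strip (w : ℝ) : Set ℂ :=
  if w = 0 then {z | z.im = 0} else {z | |z.im| < w}

/-- Sectorial operators of angle `w`. -/
structure IsSectorial (A : X →ₗ.[ℂ] X) (w : ℝ) : Prop where
  nonneg : 0 ≤ w
  lt_pi : w < Real.pi
  spectrum_subset : spectrum A ⊆ closure (sector w)
  bound : ∀ w' : ℝ, w < w' → w' < Real.pi →
    ∃ K : ℝ, ∀ z : ℂ, z ∉ closure (sector w') → ‖z • resolvent A z‖ ≤ K

/-- Strip-type operators of height `w`. -/
structure IsStripType (A : X →ₗ.[ℂ] X) (w : ℝ) : Prop where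
  nonneg : 0 ≤ w
  spectrum_subset : spectrum A ⊆ closure (strip w)
  bound : ∀ w' : ℝ, w < w' → ∃ K : ℝ, ∀ z : ℂ, w' ≤ |z.im| → ‖resolvent A z‖ ≤ K

/-- Strong strip-type operators of height `w`. -/
structure IsStrongStripType (A : X →ₗ.[ℂ] X) (w : ℝ) : Prop extends IsStripType A w where
  strong_bound : ∀ w' : ℝ, w < w' →
    ∃ K : ℝ, ∀ z : ℂ, w' < |z.im| → ‖resolvent A z‖ ≤ K / (|z.im| - w')

/-! ### The square root of a sectorial operator -/

/-- The integral of the primary sectorial functional calculus,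
`(2πi)⁻¹ ∫_Γ f(z) R(z, A) dz`, where `Γ = ∂S_d` is traversed with the sector on its left:
outwards along the ray `(0, ∞)e^{-id}`, inwards along the ray `(0, ∞)e^{id}`. -/
def contourIntegral (A : X →ₗ.[ℂ] X) (d : ℝ) (f : ℂ → ℂ) : X →L[ℂ] X :=
  (2 * Real.pi * Complex.I)⁻¹ •
    ((∫ r in Set.Ioi (0 : ℝ),
        (f (r * Complex.exp (-(d * Complex.I))) * Complex.exp (-(d * Complex.I))) •
          resolvent A (r * Complex.exp (-(d * Complex.I)))) -
      ∫ r in Set.Ioi (0 : ℝ),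
        (f (r * Complex.exp (d * Complex.I)) * Complex.exp (d * Complex.I)) •
          resolvent A (r * Complex.exp (d * Complex.I)))

/-- The operator `(1 + A) T`, with its maximal domain `{x | T x ∈ D(A)}`. -/
def oneAddComp (A : X →ₗ.[ℂ] X) (T : X →L[ℂ] X) : X →ₗ.[ℂ] X where
  domain := A.domain.comap (T : X →ₗ[ℂ] X)
  toFun :=
    { toFun := fun x => T x + A ⟨T x, x.2⟩
      map_add' := fun x y => by
        have h : (⟨T ((x + y : A.domain.comap (T : X →ₗ[ℂ] X)) : X), (x + y).2⟩ : A.domain)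
            = ⟨T x, x.2⟩ + ⟨T y, y.2⟩ := by
          ext
          simp
        rw [h, A.map_add]
        simp only [Submodule.coe_add, map_add]
        abel
      map_smul' := fun c x => by
        have h : (⟨T ((c • x : A.domain.comap (T : X →ₗ[ℂ] X)) : X), (c • x).2⟩ : A.domain)
            = c • ⟨T x, x.2⟩ := by
          ext
          simp
        rw [h, A.map_smul]
        simp only [Submodule.coe_smul, map_smul, RingHom.id_apply, smul_add] }

/-- The operator `z^{1/2}(A)` of the sectorial functional calculus, regularized by
`e(z) = (1 + z)⁻¹` (so that `e(A)⁻¹ = 1 + A`) and computed with the contour `∂S_d`: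
`A^{1/2} = e(A)⁻¹ (e(z) z^{1/2})(A) = (1 + A) (z^{1/2} / (1 + z))(A)`. -/
def sqrtAlong (A : X →ₗ.[ℂ] X) (d : ℝ) : X →ₗ.[ℂ] X :=
  oneAddComp A (contourIntegral A d fun z => z ^ (1 / 2 : ℂ) / (1 + z))

/-- `B = A^{1/2}`: the operator `A` is sectorial of some angle `w`, and `B` is the operator
`z^{1/2}(A)` of the sectorial functional calculus, for each admissible contour `∂S_d`,
`w < d < π`. -/
def IsSqrt (A B : X →ₗ.[ℂ] X) : Prop :=
  ∃ w : ℝ, IsSectorial A w ∧ ∀ d : ℝ, w < d → d < Real.pi → B = sqrtAlong A d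

theorem IsSqrt.unique {A B B' : X →ₗ.[ℂ] X} (h : IsSqrt A B) (h' : IsSqrt A B') : B = B' := by
  obtain ⟨w, hw, hB⟩ := h
  obtain ⟨w', hw', hB'⟩ := h'
  obtain ⟨d, hd, hd'⟩ := exists_between (max_lt hw.lt_pi hw'.lt_pi)
  rw [hB d (lt_of_le_of_lt (le_max_left _ _) hd) hd',
    hB' d (lt_of_le_of_lt (le_max_right _ _) hd) hd']

/-- The estimate `‖R(z², A)‖ ≤ M / (|z| |Im z|)` for all non-real `z`
(which includes `z² ∈ ϱ(A)`). -/
def SquareResolventBound (A : X →ₗ.[ℂ] X) (M : ℝ) : Prop :=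
  ∀ z : ℂ, z.im ≠ 0 →
    z ^ 2 ∈ resolventSet A ∧ ‖resolvent A (z ^ 2)‖ ≤ M / (‖z‖ * |z.im|)

end CosineSqrt

end

/-!
Part (a). For real `l > 0` the Laplace transform of the cosine function, divided by `l`, is the
resolvent of the generator `-A` at `l²`. Both sides of the resolvent equation between `l²` and `1`
are holomorphic in the right half-plane, so by the identity theorem the Laplace transform gives the
resolvent at `l²` for all `l` with `Re l > 0`, and it is bounded by `M / (|l| Re l)`. Rotating `l`
by a right angle is the claim.

Part (b). In the coordinate `z = e^u`, the hypothesis says that `u ↦ e^u R(e^u, A)` is bounded by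
`M / |sin (Im u / 2)|`, which is sectoriality of angle zero. The operator
`T = A^{1/2} (1 + A)⁻¹` becomes an integral over the lines `Im u = ∓d` against a hyperbolic secant,
and Cauchy's theorem for rectangles shows that it does not depend on `d`.

Formally, `R(l, A^{1/2}) = l R(l², A) + W(l²)` and `l (l + A^{1/2})⁻¹ = l² R(l², A) - l W(l²)` with
`W(m) = A^{1/2} R(m, A) = (1 + m) R(m, A) T - T`. The first formula makes sense for non-real `l`
only. The right-hand side of the second equals a Cauchy integral, `sqrtResolvent`, which is bounded
and holomorphic in `l` on a whole sector about the positive axis (`exp_smul_eq`, by the resolvent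
equation and one residue). This also bounds `W(m)` by a multiple of `|m|^{-1/2}`.

With `J = (1 + A)⁻¹`, both formulas hold once `T² = J - J²`, that is, `(A^{1/2})² = A`. To prove
this, consider `e(m) = (1 + A) R(m, A) (J - J² - T²)`. It is holomorphic off `[0, ∞)`. In terms of
`sqrtResolvent` it continues holomorphically across `(0, ∞)`, it is bounded at infinity, and it is
`O(|m|^{-1/2})` at the origin. So it extends to a bounded entire function and is constant;
comparing two values yields `e = 0` (`holDefect_eq_zero`). No products of contour integrals are
needed.

The first formula then bounds `R(l, A^{1/2})` by a multiple of `1 / |Im l|`, and the second one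
bounds it by a multiple of `1 / |l|` near the negative axis.
-/

noncomputable section
namespace CosineSqrt
open MeasureTheory Filter Topology Set

section
/-! ### Integrals over horizontal lines -/

theorem norm_sinh_ge (u : ℂ) : |Real.sin u.im| * Real.cosh u.re ≤ ‖Complex.sinh u‖ := by
  rw [← abs_of_nonneg (norm_nonneg (Complex.sinh u)), ← abs_of_pos (Real.cosh_pos u.re), ← abs_mul,
    ← sq_le_sq, ← Complex.normSq_eq_norm_sq]
  conv_rhs => rw [← Complex.re_add_im u, Complex.sinh_add, Complex.cosh_mul_I, Complex.sinh_mul_I]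
  rw [← Complex.ofReal_sinh, ← Complex.ofReal_cosh, ← Complex.ofReal_sin, ← Complex.ofReal_cos]
  simp only [Complex.normSq_apply, Complex.add_re, Complex.add_im, Complex.mul_re, Complex.mul_im,
    Complex.ofReal_re, Complex.ofReal_im, Complex.I_re, Complex.I_im]
  nlinarith [sq_nonneg (Real.sinh u.re * Real.cos u.im)]

theorem norm_cosh_ge (u : ℂ) : |Real.cos u.im| * Real.cosh u.re ≤ ‖Complex.cosh u‖ := by
  rw [← abs_of_nonneg (norm_nonneg (Complex.cosh u)), ← abs_of_pos (Real.cosh_pos u.re), ← abs_mul,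
    ← sq_le_sq, ← Complex.normSq_eq_norm_sq]
  conv_rhs => rw [← Complex.re_add_im u, Complex.cosh_add, Complex.cosh_mul_I, Complex.sinh_mul_I]
  rw [← Complex.ofReal_sinh, ← Complex.ofReal_cosh, ← Complex.ofReal_sin, ← Complex.ofReal_cos]
  simp only [Complex.normSq_apply, Complex.add_re, Complex.add_im, Complex.mul_re, Complex.mul_im,
    Complex.ofReal_re, Complex.ofReal_im, Complex.I_re, Complex.I_im]
  nlinarith [sq_nonneg (Real.sinh u.re * Real.sin u.im)]

theorem norm_cosh_le (u : ℂ) : ‖Complex.cosh u‖ ≤ Real.cosh u.re := by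
  rw [← abs_of_nonneg (norm_nonneg (Complex.cosh u)), ← abs_of_pos (Real.cosh_pos u.re),
    ← sq_le_sq, ← Complex.normSq_eq_norm_sq]
  conv_lhs => rw [← Complex.re_add_im u, Complex.cosh_add, Complex.cosh_mul_I, Complex.sinh_mul_I]
  rw [← Complex.ofReal_sinh, ← Complex.ofReal_cosh, ← Complex.ofReal_sin, ← Complex.ofReal_cos]
  simp only [Complex.normSq_apply, Complex.add_re, Complex.add_im, Complex.mul_re, Complex.mul_im,
    Complex.ofReal_re, Complex.ofReal_im, Complex.I_re, Complex.I_im]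
  have h1 := Real.sinh_sq u.re
  have h2 := Real.sin_sq_add_cos_sq u.im
  have : Real.cosh u.re ^ 2 = Real.cosh u.re ^ 2 * (Real.sin u.im ^ 2 + Real.cos u.im ^ 2) := by
    rw [h2, mul_one]
  nlinarith [sq_nonneg (Real.sin u.im)]

theorem hasDerivAt_two_arctan_exp (x₀ s : ℝ) :
    HasDerivAt (fun s : ℝ => 2 * Real.arctan (Real.exp ((s - x₀) / 2)) * 2)
      (Real.cosh ((s - x₀) / 2))⁻¹ s := by
  have h := (((((hasDerivAt_id s).sub_const x₀).div_const 2).exp.arctan).const_mul 2).mul_const 2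
  refine h.congr_deriv ?_
  rw [Real.cosh_eq, Real.exp_neg]
  simp only [id]
  have := Real.exp_pos ((s - x₀) / 2)
  field_simp
  ring

theorem tendsto_sub_div_two_atTop (x₀ : ℝ) : Tendsto (fun s : ℝ => (s - x₀) / 2) atTop atTop :=
  (tendsto_atTop_add_const_right _ (-x₀) tendsto_id).atTop_div_const two_pos

theorem tendsto_sub_div_two_atBot (x₀ : ℝ) : Tendsto (fun s : ℝ => (s - x₀) / 2) atBot atBot :=
  (tendsto_atBot_add_const_right _ (-x₀) tendsto_id).atBot_div_const two_pos

theorem integrable_sech (x₀ : ℝ) : Integrable fun s : ℝ => (Real.cosh ((s - x₀) / 2))⁻¹ := by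
  have h0 : Integrable fun s : ℝ => (Real.cosh (s / 2))⁻¹ := by
    have h1 : Integrable fun s : ℝ => 16 * (1 + s ^ 2)⁻¹ := integrable_inv_one_add_sq.const_mul 16
    refine h1.mono' (by fun_prop) (ae_of_all _ fun s => ?_)
    have h2 : 0 < Real.cosh (s / 2) := Real.cosh_pos _
    rw [Real.norm_eq_abs, abs_of_pos (inv_pos.2 h2), ← div_eq_mul_inv, inv_eq_one_div,
      div_le_div_iff₀ h2 (by positivity)]
    have h3 := Real.quadratic_le_exp_of_nonneg (abs_nonneg (s / 2))
    have h4 := Real.add_one_le_exp (-|s / 2|)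
    have h5 : Real.cosh (s / 2) = (Real.exp |s / 2| + Real.exp (-|s / 2|)) / 2 := by
      rw [← Real.cosh_abs, Real.cosh_eq]
    rw [sq_abs] at h3
    nlinarith
  exact h0.comp_sub_right x₀

theorem integral_sech (x₀ : ℝ) : ∫ s : ℝ, (Real.cosh ((s - x₀) / 2))⁻¹ = 2 * Real.pi := by
  have h := integral_of_hasDerivAt_of_tendsto (hasDerivAt_two_arctan_exp x₀) (integrable_sech x₀)
    (m := 2 * 0 * 2) (n := 2 * (Real.pi / 2) * 2) ?_ ?_
  · rw [h]; ring
  · refine Tendsto.mul_const _ (Tendsto.const_mul _ ?_)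
    have := (Real.continuous_arctan.tendsto 0).comp
      (Real.tendsto_exp_atBot.comp (tendsto_sub_div_two_atBot x₀))
    simpa [Function.comp_def] using this
  · refine Tendsto.mul_const _ (Tendsto.const_mul _ ?_)
    exact ((Real.tendsto_arctan_atTop.mono_right nhdsWithin_le_nhds).comp
      (Real.tendsto_exp_atTop.comp (tendsto_sub_div_two_atTop x₀)))

theorem tendsto_sech_atTop (x₀ : ℝ) :
    Tendsto (fun s : ℝ => (Real.cosh ((s - x₀) / 2))⁻¹) atTop (𝓝 0) := by
  refine tendsto_inv_atTop_zero.comp (tendsto_atTop_mono (fun s => ?_)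
    ((Real.tendsto_exp_atTop.comp (tendsto_sub_div_two_atTop x₀)).atTop_div_const two_pos))
  rw [Real.cosh_eq]
  simp only [Function.comp]
  gcongr
  linarith [Real.exp_pos (-((s - x₀) / 2))]

theorem tendsto_sech_neg_atTop (x₀ : ℝ) :
    Tendsto (fun s : ℝ => (Real.cosh ((-s - x₀) / 2))⁻¹) atTop (𝓝 0) := by
  refine (tendsto_sech_atTop (-x₀)).congr fun s => ?_
  rw [← Real.cosh_neg]
  ring_nf

variable {E : Type*} [NormedAddCommGroup E]

theorem integrable_line {g : ℂ → E} {a x₀ K : ℝ}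
    (hd : ∀ u : ℂ, u.im = a → ContinuousAt g u)
    (hb : ∀ u : ℂ, u.im = a → ‖g u‖ ≤ K * (Real.cosh ((u.re - x₀) / 2))⁻¹) :
    Integrable fun s : ℝ => g (s + a * Complex.I) := by
  have hc : Continuous fun s : ℝ => g (s + a * Complex.I) := by
    refine continuous_iff_continuousAt.2 fun s => ?_
    exact ContinuousAt.comp (f := fun s : ℝ => (s + a * Complex.I : ℂ)) (hd _ (by simp))
      (by fun_prop)
  refine ((integrable_sech x₀).const_mul K).mono' hc.aestronglyMeasurable (ae_of_all _ fun s => ?_)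
  simpa using hb (s + a * Complex.I) (by simp)

/-- Cauchy's theorem for a strip: the vertical sides of the rectangles disappear in the limit because
`g` decays like a hyperbolic secant. -/
theorem integral_line_eq [NormedSpace ℂ E] [CompleteSpace E] {g : ℂ → E} {a b x₀ K : ℝ}
    (hd : ∀ u : ℂ, u.im ∈ uIcc a b → DifferentiableAt ℂ g u)
    (hb : ∀ u : ℂ, u.im ∈ uIcc a b → ‖g u‖ ≤ K * (Real.cosh ((u.re - x₀) / 2))⁻¹) :
    ∫ s : ℝ, g (s + a * Complex.I) = ∫ s : ℝ, g (s + b * Complex.I) := by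
  have hI : ∀ c ∈ uIcc a b, Tendsto (fun N : ℝ => ∫ s in (-N)..N, g (s + c * Complex.I)) atTop
      (𝓝 (∫ s : ℝ, g (s + c * Complex.I))) := fun c hc =>
    intervalIntegral_tendsto_integral
      (integrable_line (fun u hu => (hd u (hu ▸ hc)).continuousAt) fun u hu => hb u (hu ▸ hc))
      tendsto_neg_atTop_atBot tendsto_id
  have hV : ∀ σ : ℝ → ℝ, Tendsto (fun N => (Real.cosh ((σ N - x₀) / 2))⁻¹) atTop (𝓝 0) →
      Tendsto (fun N : ℝ => Complex.I • ∫ y in a..b, g (σ N + y * Complex.I)) atTop (𝓝 0) := by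
    intro σ hσ
    have h0 : Tendsto (fun N => K * (Real.cosh ((σ N - x₀) / 2))⁻¹ * |b - a|) atTop (𝓝 0) := by
      simpa using (hσ.const_mul K).mul_const |b - a|
    refine squeeze_zero_norm (fun N => ?_) h0
    rw [norm_smul, Complex.norm_I, one_mul]
    refine intervalIntegral.norm_integral_le_of_norm_le_const fun y hy => ?_
    simpa using hb (σ N + y * Complex.I) (by simpa using uIoc_subset_uIcc hy)
  have h := (((hI a left_mem_uIcc).sub (hI b right_mem_uIcc)).add
    (hV (fun N => N) (tendsto_sech_atTop x₀))).sub (hV (fun N => -N) (tendsto_sech_neg_atTop x₀))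
  rw [add_zero, sub_zero] at h
  refine sub_eq_zero.1 (tendsto_nhds_unique h ?_)
  refine tendsto_const_nhds.congr fun N => ?_
  have h' := Complex.integral_boundary_rect_eq_zero_of_differentiableOn g (-N + a * Complex.I)
    (N + b * Complex.I) (fun u hu => (hd u ?_).differentiableWithinAt)
  · simpa using h'.symm
  · simpa using hu.2

end

section
variable {X : Type*} [NormedAddCommGroup X] [NormedSpace ℂ X]

/-! ### Resolvents -/

theorem isResolventAt_resolvent {A : X →ₗ.[ℂ] X} {z : ℂ} (h : z ∈ resolventSet A) :
    IsResolventAt A z (resolvent A z) := by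
  obtain ⟨R, hR⟩ := h
  rwa [resolvent_eq hR]

theorem IsResolventAt.sub_eq {A : X →ₗ.[ℂ] X} {z w : ℂ} {R S : X →L[ℂ] X}
    (hR : IsResolventAt A z R) (hS : IsResolventAt A w S) : R - S = (w - z) • (R * S) := by
  ext x
  obtain ⟨h, hx⟩ := hS.1 x
  have h1 := hR.2 ⟨S x, h⟩
  have h2 : x = (z • S x - A ⟨S x, h⟩) + (w - z) • S x := by
    rw [sub_smul]
    nth_rewrite 1 [← hx]
    abel
  have h3 : R x = S x + (w - z) • R (S x) := by
    nth_rewrite 1 [h2]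
    rw [map_add, map_smul, h1]
  simp [h3]

theorem IsResolventAt.commute {A : X →ₗ.[ℂ] X} {z w : ℂ} {R S : X →L[ℂ] X}
    (hR : IsResolventAt A z R) (hS : IsResolventAt A w S) : Commute R S := by
  rcases eq_or_ne z w with rfl | hzw
  · rw [hR.unique hS]
  · have h1 := hR.sub_eq hS
    have h2 := hS.sub_eq hR
    have h3 : (w - z) • (R * S) = (w - z) • (S * R) := by
      rw [← h1, ← neg_sub S R, h2, ← neg_smul, neg_sub]
    exact smul_right_injective _ (sub_ne_zero.2 hzw.symm) h3

theorem IsResolventAt.eq_zero {A : X →ₗ.[ℂ] X} {z : ℂ} {R : X →L[ℂ] X}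
    (hR : IsResolventAt A z R) {x : X} (hx : R x = 0) : x = 0 := by
  obtain ⟨h, h'⟩ := hR.1 x
  have h0 : (⟨R x, h⟩ : A.domain) = 0 := Subtype.ext hx
  rw [h0, hx, smul_zero, LinearPMap.map_zero, sub_zero] at h'
  exact h'.symm

theorem IsResolventAt.mul_left_cancel {A : X →ₗ.[ℂ] X} {z : ℂ} {R S T : X →L[ℂ] X}
    (hR : IsResolventAt A z R) (h : R * S = R * T) : S = T := by
  ext x
  refine sub_eq_zero.1 (hR.eq_zero ?_)
  have := DFunLike.congr_fun h x
  simpa [sub_eq_zero] using this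

/-- A solution `R` of the resolvent equation relative to a resolvent `S` is itself a resolvent. -/
theorem IsResolventAt.of_sub_eq {A : X →ₗ.[ℂ] X} {z w : ℂ} {R S : X →L[ℂ] X}
    (hS : IsResolventAt A w S) (h₁ : R - S = (w - z) • (R * S)) (h₂ : R - S = (w - z) • (S * R)) :
    IsResolventAt A z R := by
  constructor
  · intro x
    have hx : R x = S (x + (w - z) • R x) := by
      have := DFunLike.congr_fun h₂ x
      simp only [sub_apply, smul_apply, mul_apply_eq_comp, sub_eq_iff_eq_add'] at this
      rw [map_add, map_smul, ← this]
    obtain ⟨h, h'⟩ := hS.1 (x + (w - z) • R x)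
    have h0 : R x ∈ A.domain := hx ▸ h
    refine ⟨h0, ?_⟩
    have h3 : (⟨R x, h0⟩ : A.domain) = ⟨S (x + (w - z) • R x), h⟩ := Subtype.ext hx
    rw [← h3, ← hx, sub_smul] at h'
    rw [← sub_eq_zero] at h' ⊢
    rw [← h']
    abel
  · intro y
    have h1 := hS.2 y
    have h3 : R (w • (y : X) - A y) = y + (w - z) • R y := by
      have := DFunLike.congr_fun h₁ (w • (y : X) - A y)
      simp only [sub_apply, smul_apply, mul_apply_eq_comp, sub_eq_iff_eq_add'] at this
      rw [this, h1]
    rw [map_sub, map_smul, sub_smul] at h3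
    rw [map_sub, map_smul, ← sub_eq_zero]
    rw [← sub_eq_zero] at h3
    rw [← h3]
    abel

/-- The resolvent is holomorphic in the interior of the resolvent set. -/
theorem differentiableAt_resolvent [CompleteSpace X] {A : X →ₗ.[ℂ] X} {z : ℂ}
    (h : ∀ᶠ w in 𝓝 z, w ∈ resolventSet A) : DifferentiableAt ℂ (resolvent A) z := by
  set R := resolvent A z
  have hR : IsResolventAt A z R := isResolventAt_resolvent h.self_of_nhds
  have h1 : ContinuousAt (fun w : ℂ => (1 : X →L[ℂ] X) + (w - z) • R) z := by fun_prop
  have h2 : ∀ᶠ w in 𝓝 z, IsUnit ((1 : X →L[ℂ] X) + (w - z) • R) := by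
    refine h1 (Units.isOpen.mem_nhds ?_)
    simp
  have h3 : resolvent A =ᶠ[𝓝 z] fun w => Ring.inverse (1 + (w - z) • R) * R := by
    filter_upwards [h, h2] with w hw hu
    have h4 := hR.sub_eq (isResolventAt_resolvent hw)
    have h5 : (1 + (w - z) • R) * resolvent A w = R := by
      rw [add_mul, one_mul, smul_mul_assoc, ← h4]
      abel
    have h6 := congrArg (Ring.inverse (1 + (w - z) • R) * ·) h5
    simpa only [← mul_assoc, Ring.inverse_mul_cancel _ hu, one_mul] using h6
  refine DifferentiableAt.congr_of_eventuallyEq ?_ h3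
  refine DifferentiableAt.mul ?_ (differentiableAt_const _)
  exact (differentiableAt_inverse (𝕜 := ℂ) (by simp)).comp z
    (f := fun w : ℂ => (1 : X →L[ℂ] X) + (w - z) • R) (by fun_prop)

/-! ### Logarithmic coordinates -/

theorem neg_exp_mem_slitPlane {u : ℂ} (h : Real.sin (u.im / 2) ≠ 0) :
    -Complex.exp u ∈ Complex.slitPlane := by
  rw [Complex.mem_slitPlane_iff, Complex.neg_re, Complex.neg_im, Complex.exp_re, Complex.exp_im]
  by_contra! h'
  have hx := Real.exp_pos u.re
  have h1 : Real.sin u.im = 0 := by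
    have := neg_eq_zero.1 h'.2
    exact (mul_eq_zero.1 this).resolve_left hx.ne'
  have h2 : 0 ≤ Real.cos u.im := by
    by_contra! h3
    nlinarith [h'.1, mul_pos hx (neg_pos.2 h3)]
  have h4 := Real.sin_sq_add_cos_sq u.im
  have h5 : Real.cos u.im = 1 := by nlinarith
  have h6 : u.im = 2 * (u.im / 2) := by ring
  rw [h6, Real.cos_two_mul, Real.cos_sq'] at h5
  exact h (pow_eq_zero_iff two_ne_zero |>.1 (by linarith))

theorem neg_mem_slitPlane_iff {z : ℂ} :
    -z ∈ Complex.slitPlane ↔ ¬ ∃ t : ℝ, 0 ≤ t ∧ z = t := by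
  rw [← not_iff_not, Complex.mem_slitPlane_iff, not_not, Complex.neg_re, Complex.neg_im]
  push Not
  refine ⟨fun h => ⟨z.re, by linarith [h.1], Complex.ext rfl (neg_eq_zero.1 h.2)⟩, ?_⟩
  rintro ⟨t, ht, rfl⟩
  simpa using ht

/-- Off `[0, ∞)` the logarithmic coordinate is taken with `0 < Im u < 2π`, so that the square root
`e^{u/2}` lies in the upper half-plane. -/
theorem exists_exp_eq {z : ℂ} (hz : -z ∈ Complex.slitPlane) :
    ∃ u : ℂ, 0 < u.im ∧ u.im < 2 * Real.pi ∧ Complex.exp u = z := by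
  have h1 := Complex.neg_pi_lt_arg (-z)
  have h2 := (Complex.arg_le_pi (-z)).lt_of_ne (Complex.slitPlane_arg_ne_pi hz)
  refine ⟨Complex.log (-z) + Real.pi * Complex.I, ?_, ?_, ?_⟩
  · simp [Complex.log_im]; linarith
  · simp [Complex.log_im]; linarith
  · rw [Complex.exp_add, Complex.exp_log (Complex.slitPlane_ne_zero hz), Complex.exp_pi_mul_I]
    ring

/-- The dilation-invariant form `u ↦ e^u R(e^u, A)` of the resolvent in the logarithmic
coordinate `z = e^u`. -/
def expResolvent (A : X →ₗ.[ℂ] X) (u : ℂ) : X →L[ℂ] X :=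
  Complex.exp u • resolvent A (Complex.exp u)

variable {A : X →ₗ.[ℂ] X} {M : ℝ}

theorem SquareResolventBound.nonneg (h : SquareResolventBound A M) : 0 ≤ M := by
  have := (norm_nonneg _).trans (h Complex.I (by simp)).2
  simpa using this

theorem SquareResolventBound.exp_mem (h : SquareResolventBound A M) {u : ℂ}
    (hu : Real.sin (u.im / 2) ≠ 0) : Complex.exp u ∈ resolventSet A := by
  have hh : Complex.exp u = Complex.exp (u / 2) ^ 2 := by
    rw [← Complex.exp_nat_mul]; congr 1; push_cast; ring
  rw [hh]
  refine (h _ ?_).1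
  rw [Complex.exp_im]
  exact mul_ne_zero (Real.exp_pos _).ne' (by simpa using hu)

theorem SquareResolventBound.norm_expResolvent_le (h : SquareResolventBound A M) {u : ℂ}
    (hu : Real.sin (u.im / 2) ≠ 0) : ‖expResolvent A u‖ ≤ M / |Real.sin (u.im / 2)| := by
  have hh : Complex.exp u = Complex.exp (u / 2) ^ 2 := by
    rw [← Complex.exp_nat_mul]; congr 1; push_cast; ring
  have him : (Complex.exp (u / 2)).im = Real.exp (u / 2).re * Real.sin (u.im / 2) := by
    rw [Complex.exp_im]; simp
  have hx := Real.exp_pos (u / 2).re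
  have h1 := (h (Complex.exp (u / 2)) (by rw [him]; exact mul_ne_zero hx.ne' hu)).2
  rw [expResolvent, norm_smul, hh, norm_pow]
  refine (mul_le_mul_of_nonneg_left h1 (by positivity)).trans_eq ?_
  rw [him, abs_mul, abs_of_pos hx, Complex.norm_exp]
  have := abs_pos.2 hu
  field_simp

theorem SquareResolventBound.mem_resolventSet (h : SquareResolventBound A M) {z : ℂ}
    (hz : -z ∈ Complex.slitPlane) : z ∈ resolventSet A := by
  obtain ⟨u, h0, h1, rfl⟩ := exists_exp_eq hz
  exact h.exp_mem (Real.sin_pos_of_pos_of_lt_pi (by linarith) (by linarith)).ne'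

theorem SquareResolventBound.isResolventAt (h : SquareResolventBound A M) {z : ℂ}
    (hz : -z ∈ Complex.slitPlane) : IsResolventAt A z (resolvent A z) :=
  isResolventAt_resolvent (h.mem_resolventSet hz)

theorem SquareResolventBound.spectrum_subset (h : SquareResolventBound A M) :
    spectrum A ⊆ {z : ℂ | ∃ t : ℝ, 0 ≤ t ∧ z = t} := by
  intro z hz
  by_contra hz'
  exact hz (h.mem_resolventSet (neg_mem_slitPlane_iff.2 hz'))

theorem SquareResolventBound.differentiableAt_resolvent [CompleteSpace X]
    (h : SquareResolventBound A M) {z : ℂ} (hz : -z ∈ Complex.slitPlane) :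
    DifferentiableAt ℂ (resolvent A) z := by
  refine CosineSqrt.differentiableAt_resolvent ?_
  have := (continuous_neg.isOpen_preimage _ Complex.isOpen_slitPlane).mem_nhds hz
  filter_upwards [this] with w hw using h.mem_resolventSet hw

theorem SquareResolventBound.differentiableAt_expResolvent [CompleteSpace X]
    (h : SquareResolventBound A M) {u : ℂ} (hu : Real.sin (u.im / 2) ≠ 0) :
    DifferentiableAt ℂ (expResolvent A) u :=
  Complex.differentiableAt_exp.smul
    ((h.differentiableAt_resolvent (neg_exp_mem_slitPlane hu)).comp u Complex.differentiableAt_exp)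

end

section
variable {X : Type*} [NormedAddCommGroup X] [NormedSpace ℂ X]

/-! ### Laplace transforms of bounded cosine functions -/

theorem growthBound_eq_zero {C : ℝ → X →L[ℂ] X} {M : ℝ} (hM : 1 ≤ M) (hC : ∀ t, ‖C t‖ ≤ M) :
    growthBound C = 0 := by
  refine le_antisymm (csInf_le ⟨0, fun w hw => hw.1⟩ ⟨le_rfl, M, hM, fun t => ?_⟩)
    (Real.sInf_nonneg fun w hw => hw.1)
  simpa using hC t

/-- The Laplace transform `∫₀^∞ e^{-mt} C(t) x dt`. -/
def laplaceTransform (C : ℝ → X →L[ℂ] X) (m : ℂ) (x : X) : X :=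
  ∫ t in Ioi (0 : ℝ), Complex.exp (-(m * t)) • C t x

section
variable {C : ℝ → X →L[ℂ] X} {M : ℝ}

theorem norm_laplace_integrand_le (hC : ∀ t, ‖C t‖ ≤ M) (m : ℂ) (x : X) (t : ℝ) :
    ‖Complex.exp (-(m * t)) • C t x‖ ≤ M * ‖x‖ * Real.exp (-m.re * t) := by
  rw [norm_smul, Complex.norm_exp, mul_comm]
  have h1 : (-(m * t)).re = -m.re * t := by simp
  rw [h1]
  exact mul_le_mul_of_nonneg_right ((C t).le_of_opNorm_le (hC t) x) (Real.exp_pos _).le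

theorem integrable_laplace (hC : ∀ t, ‖C t‖ ≤ M)
    (hc : ∀ x, Continuous fun t => C t x) {m : ℂ} (hm : 0 < m.re) (x : X) :
    IntegrableOn (fun t : ℝ => Complex.exp (-(m * t)) • C t x) (Ioi 0) := by
  refine Integrable.mono' ((exp_neg_integrableOn_Ioi 0 hm).const_mul (M * ‖x‖)) ?_
    (ae_of_all _ fun t => norm_laplace_integrand_le hC m x t)
  have := hc x
  exact (by fun_prop : Continuous fun t : ℝ => Complex.exp (-(m * t)) • C t x).aestronglyMeasurable

theorem norm_laplaceTransform_le (hC : ∀ t, ‖C t‖ ≤ M) {m : ℂ} (hm : 0 < m.re) (x : X) :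
    ‖laplaceTransform C m x‖ ≤ M / m.re * ‖x‖ := by
  refine (norm_integral_le_of_norm_le ((exp_neg_integrableOn_Ioi 0 hm).const_mul (M * ‖x‖))
    (ae_of_all _ fun t => norm_laplace_integrand_le hC m x t)).trans_eq ?_
  rw [integral_const_mul, integral_exp_mul_Ioi (neg_neg_of_pos hm)]
  simp
  field_simp

theorem differentiableAt_laplaceTransform [CompleteSpace X] (hC : ∀ t, ‖C t‖ ≤ M)
    (hc : ∀ x, Continuous fun t => C t x) {m : ℂ} (hm : 0 < m.re) (x : X) :
    DifferentiableAt ℂ (fun m => laplaceTransform C m x) m := by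
  have hr : 0 < m.re / 2 := by positivity
  have hs : {w : ℂ | m.re / 2 < w.re} ∈ 𝓝 m :=
    (isOpen_lt continuous_const Complex.continuous_re).mem_nhds (by simp; linarith)
  have hx := hc x
  have hcont : ∀ w : ℂ, Continuous fun t : ℝ => Complex.exp (-(w * t)) • C t x :=
    fun w => by fun_prop
  have hM : 0 ≤ M := (norm_nonneg _).trans (hC 0)
  -- The factor `t` from the derivative costs half of the remaining exponential decay.
  refine (hasDerivAt_integral_of_dominated_loc_of_deriv_le (μ := volume.restrict (Ioi 0))
    (F := fun (w : ℂ) (t : ℝ) => Complex.exp (-(w * t)) • C t x)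
    (F' := fun (w : ℂ) (t : ℝ) => (Complex.exp (-(w * t)) * -t) • C t x)
    (bound := fun t : ℝ => 4 / m.re * (M * ‖x‖) * Real.exp (-(m.re / 4) * t)) hs
    (Eventually.of_forall fun w => (hcont w).aestronglyMeasurable)
    (integrable_laplace hC hc hm x) ?_ ?_ ?_ ?_).2.differentiableAt
  · exact (by fun_prop : Continuous fun t : ℝ =>
      (Complex.exp (-(m * t)) * -t) • C t x).aestronglyMeasurable
  · filter_upwards [ae_restrict_mem measurableSet_Ioi] with t ht w hw
    have ht0 : 0 < t := ht
    rw [mul_comm, mul_smul, norm_smul, norm_neg, Complex.norm_real, Real.norm_of_nonneg ht0.le]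
    refine (mul_le_mul_of_nonneg_left (norm_laplace_integrand_le hC w x t) ht0.le).trans ?_
    have h1 : Real.exp (-w.re * t) ≤ Real.exp (-(m.re / 4) * t) * Real.exp (-(m.re / 4 * t)) := by
      rw [← Real.exp_add]
      refine Real.exp_le_exp.2 ?_
      have : m.re / 2 < w.re := hw
      nlinarith
    have h2 : t * Real.exp (-(m.re / 4 * t)) ≤ 4 / m.re := by
      rw [Real.exp_neg, ← div_eq_mul_inv, div_le_div_iff₀ (Real.exp_pos _) hm]
      have := Real.add_one_le_exp (m.re / 4 * t)
      linarith
    calc t * (M * ‖x‖ * Real.exp (-w.re * t))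
        ≤ t * (M * ‖x‖ * (Real.exp (-(m.re / 4) * t) * Real.exp (-(m.re / 4 * t)))) := by gcongr
      _ = (t * Real.exp (-(m.re / 4 * t))) * (M * ‖x‖ * Real.exp (-(m.re / 4) * t)) := by ring
      _ ≤ 4 / m.re * (M * ‖x‖ * Real.exp (-(m.re / 4) * t)) := by gcongr
      _ = _ := by ring
  · exact (exp_neg_integrableOn_Ioi 0 (by positivity)).const_mul _
  · refine ae_of_all _ fun t w _ => ?_
    have h : HasDerivAt (fun w : ℂ => -(w * (t : ℂ))) (-t) w :=
      ((hasDerivAt_id w).mul_const (t : ℂ)).neg.congr_deriv (by simp)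
    exact h.cexp.smul_const (C t x)

theorem laplaceTransform_add (hC : ∀ t, ‖C t‖ ≤ M)
    (hc : ∀ x, Continuous fun t => C t x) {m : ℂ} (hm : 0 < m.re) (x y : X) :
    laplaceTransform C m (x + y) = laplaceTransform C m x + laplaceTransform C m y := by
  rw [laplaceTransform, laplaceTransform, laplaceTransform,
    ← integral_add (integrable_laplace hC hc hm x) (integrable_laplace hC hc hm y)]
  simp

theorem laplaceTransform_smul (m c : ℂ) (x : X) :
    laplaceTransform C m (c • x) = c • laplaceTransform C m x := by
  rw [laplaceTransform, laplaceTransform, ← integral_smul]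
  simp [smul_comm c]

/-- The Laplace transform divided by `m`, as a bounded operator: the candidate for the resolvent
of the generator at `m²`. -/
def laplaceResolvent (hC : ∀ t, ‖C t‖ ≤ M)
    (hc : ∀ x, Continuous fun t => C t x) {m : ℂ} (hm : 0 < m.re) : X →L[ℂ] X :=
  m⁻¹ • LinearMap.mkContinuous
    { toFun := laplaceTransform C m
      map_add' := laplaceTransform_add hC hc hm
      map_smul' := laplaceTransform_smul m }
    (M / m.re) (norm_laplaceTransform_le hC hm)

theorem norm_laplaceResolvent_le (hC : ∀ t, ‖C t‖ ≤ M)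
    (hc : ∀ x, Continuous fun t => C t x) {m : ℂ} (hm : 0 < m.re) :
    ‖laplaceResolvent hC hc hm‖ ≤ M / (‖m‖ * m.re) := by
  have hM : 0 ≤ M := (norm_nonneg _).trans (hC 0)
  rw [laplaceResolvent, norm_smul, norm_inv]
  refine (mul_le_mul_of_nonneg_left (LinearMap.mkContinuous_norm_le _ (by positivity) _)
    (by positivity)).trans_eq ?_
  field_simp

end

/-- Identity theorem on the right half-plane, for functions that vanish on the positive axis. -/
theorem eq_zero_of_eq_zero_on_pos [CompleteSpace X] {φ : ℂ → X}
    (hφ : ∀ m : ℂ, 0 < m.re → DifferentiableAt ℂ φ m) (h0 : ∀ t : ℝ, 0 < t → φ t = 0)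
    {m : ℂ} (hm : 0 < m.re) : φ m = 0 := by
  have hU : IsOpen {m : ℂ | 0 < m.re} := isOpen_lt continuous_const Complex.continuous_re
  have hA : AnalyticOnNhd ℂ φ {m : ℂ | 0 < m.re} :=
    DifferentiableOn.analyticOnNhd (fun w hw => (hφ w hw).differentiableWithinAt) hU
  refine hA.eqOn_zero_of_preconnected_of_frequently_eq_zero
    (convex_halfSpace_re_gt 0).isPreconnected (z₀ := 1) (by simp) ?_ hm
  have ht : Tendsto (fun t : ℝ => (t : ℂ)) (𝓝[≠] 1) (𝓝[≠] 1) := by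
    refine tendsto_nhdsWithin_iff.2 ⟨?_, ?_⟩
    · simpa using (Complex.continuous_ofReal.tendsto 1).mono_left nhdsWithin_le_nhds
    · filter_upwards [self_mem_nhdsWithin] with t ht
      simpa using ht
  refine ht.frequently (Eventually.frequently ?_)
  filter_upwards [nhdsWithin_le_nhds (Ioi_mem_nhds one_pos)] with t ht using h0 t ht

/-- The Laplace representation of the resolvent of the generator extends from the positive axis
to the right half-plane, because both sides of the resolvent equation are holomorphic there. -/
theorem IsGenerator.isResolventAt [CompleteSpace X] {C : ℝ → X →L[ℂ] X} {G : X →ₗ.[ℂ] X} {M : ℝ}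
    (hG : IsGenerator C G) (hM : 1 ≤ M) (hC : ∀ t, ‖C t‖ ≤ M) (hc : ∀ x, Continuous fun t => C t x)
    {m : ℂ} (hm : 0 < m.re) : IsResolventAt G (m ^ 2) (laplaceResolvent hC hc hm) := by
  have hreal : ∀ t : ℝ, 0 < t → IsResolventAt G ((t : ℂ) ^ 2) (resolvent G ((t : ℂ) ^ 2)) ∧
      ∀ x, resolvent G ((t : ℂ) ^ 2) x = (t : ℂ)⁻¹ • laplaceTransform C t x := by
    intro t ht
    obtain ⟨h1, h2⟩ := hG t (by rwa [growthBound_eq_zero hM hC])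
    refine ⟨isResolventAt_resolvent h1, fun x => ?_⟩
    rw [laplaceTransform, ← h2 x, smul_smul, inv_mul_cancel₀ (by exact_mod_cast ht.ne'), one_smul]
  set S := resolvent G 1 with hS
  have hS1 : IsResolventAt G 1 S := by simpa using (hreal 1 one_pos).1
  have hne : ∀ m : ℂ, 0 < m.re → m ≠ 0 := by
    rintro m hm rfl
    simp at hm
  have hd : ∀ x : X, ∀ m : ℂ, 0 < m.re →
      DifferentiableAt ℂ (fun m => m⁻¹ • laplaceTransform C m x) m := fun x m hm =>
    (differentiableAt_inv (hne m hm)).smul (differentiableAt_laplaceTransform hC hc hm x)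
  refine hS1.of_sub_eq ?_ ?_
  · ext x
    refine sub_eq_zero.1 (eq_zero_of_eq_zero_on_pos (φ := fun m =>
      m⁻¹ • laplaceTransform C m x - S x - (1 - m ^ 2) • m⁻¹ • laplaceTransform C m (S x))
      (fun m hm => ?_) (fun t ht => ?_) hm)
    · exact ((hd x m hm).sub_const _).sub
        (((differentiableAt_const _).sub (differentiableAt_pow 2)).smul (hd (S x) m hm))
    · have := DFunLike.congr_fun ((hreal t ht).1.sub_eq hS1) x
      simp only [← (hreal t ht).2]
      exact sub_eq_zero.2 this
  · ext x
    refine sub_eq_zero.1 (eq_zero_of_eq_zero_on_pos (φ := fun m =>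
      m⁻¹ • laplaceTransform C m x - S x - (1 - m ^ 2) • S (m⁻¹ • laplaceTransform C m x))
      (fun m hm => ?_) (fun t ht => ?_) hm)
    · exact ((hd x m hm).sub_const _).sub
        (((differentiableAt_const _).sub (differentiableAt_pow 2)).smul
          (S.differentiableAt.comp m (hd x m hm)))
    · have h1 := (hreal t ht).1.sub_eq hS1
      rw [((hreal t ht).1.commute hS1).eq] at h1
      simp only [← (hreal t ht).2]
      exact sub_eq_zero.2 (DFunLike.congr_fun h1 x)

theorem IsResolventAt.of_neg {A : X →ₗ.[ℂ] X} {z : ℂ} {R : X →L[ℂ] X}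
    (h : IsResolventAt (-A) z R) : IsResolventAt A (-z) (-R) := by
  constructor
  · intro x
    obtain ⟨h1, h2⟩ := h.1 x
    have h3 : R x ∈ A.domain := h1
    refine ⟨A.domain.neg_mem h3, ?_⟩
    have h4 : (⟨(-R) x, A.domain.neg_mem h3⟩ : A.domain) = -⟨R x, h3⟩ := rfl
    rw [h4, LinearPMap.map_neg]
    rw [LinearPMap.neg_apply] at h2
    simpa using h2
  · intro y
    have := h.2 y
    rw [LinearPMap.neg_apply] at this
    refine Eq.trans ?_ this
    rw [neg_apply, ← map_neg]
    congr 1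
    simp [add_comm]

theorem IsCosineFunction.squareResolventBound [CompleteSpace X] {C : ℝ → X →L[ℂ] X}
    {A : X →ₗ.[ℂ] X} {M : ℝ} (h : IsCosineFunction C) (hM : 1 ≤ M) (hC : ∀ t, ‖C t‖ ≤ M)
    (hG : IsGenerator C (-A)) : SquareResolventBound A M := by
  intro z hz
  obtain ⟨m, hm, hmz, hsq, hn⟩ : ∃ m : ℂ, 0 < m.re ∧ m.re = |z.im| ∧ -m ^ 2 = z ^ 2 ∧
      ‖m‖ = ‖z‖ := by
    rcases lt_or_gt_of_ne hz with h | h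
    · exact ⟨Complex.I * z, by simpa using h, by simp [abs_of_neg h],
        by rw [mul_pow, Complex.I_sq]; ring, by simp⟩
    · exact ⟨-(Complex.I * z), by simpa using h, by simp [abs_of_pos h],
        by rw [neg_sq, mul_pow, Complex.I_sq]; ring, by simp⟩
  have h1 := (hG.isResolventAt hM hC h.continuous hm).of_neg
  rw [hsq] at h1
  refine ⟨⟨_, h1⟩, ?_⟩
  rw [resolvent_eq h1, norm_neg, ← hmz, ← hn]
  exact norm_laplaceResolvent_le hC h.continuous hm

end

section
/-! ### Pairs of horizontal lines -/

section
variable {E : Type*} [NormedAddCommGroup E] [NormedSpace ℂ E]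

/-- The contour integral over `∂S_d` in the logarithmic coordinate: the normalized difference of
the integrals of `g` over the lines `Im u = -d` and `Im u = d`. -/
def lineDiff (d : ℝ) (g : ℂ → E) : E :=
  (2 * Real.pi * Complex.I)⁻¹ • ((∫ s : ℝ, g (s + (-d : ℝ) * Complex.I)) -
    ∫ s : ℝ, g (s + d * Complex.I))

/-- Integrability over the two lines that enter `lineDiff`. -/
def LineIntegrable {E : Type*} [NormedAddCommGroup E] (d : ℝ) (g : ℂ → E) : Prop :=
  (Integrable fun s : ℝ => g (s + (-d : ℝ) * Complex.I)) ∧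
    Integrable fun s : ℝ => g (s + d * Complex.I)

theorem lineIntegrable_of_bound {E : Type*} [NormedAddCommGroup E] {g : ℂ → E} {d x₀ K : ℝ} (hd0 : 0 ≤ d)
    (hd : ∀ u : ℂ, |u.im| = d → ContinuousAt g u)
    (hb : ∀ u : ℂ, |u.im| = d → ‖g u‖ ≤ K * (Real.cosh ((u.re - x₀) / 2))⁻¹) :
    LineIntegrable d g :=
  ⟨integrable_line (fun u hu => hd u (by rw [hu, abs_neg, abs_of_nonneg hd0]))
      fun u hu => hb u (by rw [hu, abs_neg, abs_of_nonneg hd0]),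
    integrable_line (fun u hu => hd u (by rw [hu, abs_of_nonneg hd0]))
      fun u hu => hb u (by rw [hu, abs_of_nonneg hd0])⟩

theorem LineIntegrable.add {E : Type*} [NormedAddCommGroup E] {d : ℝ} {f g : ℂ → E}
    (hf : LineIntegrable d f) (hg : LineIntegrable d g) : LineIntegrable d fun u => f u + g u :=
  ⟨hf.1.add hg.1, hf.2.add hg.2⟩

theorem lineDiff_add {d : ℝ} {f g : ℂ → E} (hf : LineIntegrable d f) (hg : LineIntegrable d g) :
    lineDiff d (fun u => f u + g u) = lineDiff d f + lineDiff d g := by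
  simp only [lineDiff]
  rw [integral_add hf.1 hg.1, integral_add hf.2 hg.2, ← smul_add]
  congr 1
  abel

theorem lineDiff_sub {d : ℝ} {f g : ℂ → E} (hf : LineIntegrable d f) (hg : LineIntegrable d g) :
    lineDiff d (fun u => f u - g u) = lineDiff d f - lineDiff d g := by
  simp only [lineDiff]
  rw [integral_sub hf.1 hg.1, integral_sub hf.2 hg.2, ← smul_sub]
  congr 1
  abel

theorem lineDiff_const_smul (d : ℝ) (c : ℂ) (g : ℂ → E) :
    lineDiff d (fun u => c • g u) = c • lineDiff d g := by
  simp only [lineDiff]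
  rw [integral_smul, integral_smul, ← smul_sub, smul_comm]

theorem lineDiff_smul_const [CompleteSpace E] (d : ℝ) (f : ℂ → ℂ) (c : E) :
    lineDiff d (fun u => f u • c) = lineDiff d f • c := by
  simp only [lineDiff]
  rw [integral_smul_const, integral_smul_const, ← sub_smul, smul_smul, smul_eq_mul]

theorem lineDiff_congr {d : ℝ} {f g : ℂ → E} (hd0 : 0 ≤ d)
    (h : ∀ u : ℂ, |u.im| = d → f u = g u) : lineDiff d f = lineDiff d g := by
  simp only [lineDiff]
  congr 3 <;>
  · ext s
    exact h _ (by simp [abs_of_nonneg hd0])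

theorem norm_lineDiff_le {g : ℂ → E} {d x₀ K : ℝ} (hd0 : 0 ≤ d)
    (hb : ∀ u : ℂ, |u.im| = d → ‖g u‖ ≤ K * (Real.cosh ((u.re - x₀) / 2))⁻¹) :
    ‖lineDiff d g‖ ≤ 2 * K := by
  have h : ∀ c : ℝ, |c| = d → ‖∫ s : ℝ, g (s + c * Complex.I)‖ ≤ K * (2 * Real.pi) := by
    intro c hc
    rw [← integral_sech x₀, ← integral_const_mul]
    refine norm_integral_le_of_norm_le ((integrable_sech x₀).const_mul K) (ae_of_all _ fun s => ?_)
    simpa using hb (s + c * Complex.I) (by simpa using hc)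
  have h1 := h (-d) (by rw [abs_neg, abs_of_nonneg hd0])
  have h2 := h d (abs_of_nonneg hd0)
  have hpi := Real.pi_pos
  have h3 : ‖(2 * Real.pi * Complex.I : ℂ)⁻¹‖ = (2 * Real.pi)⁻¹ := by
    simp [abs_of_pos hpi]
  rw [lineDiff, norm_smul, h3]
  refine (mul_le_mul_of_nonneg_left ((norm_sub_le _ _).trans (add_le_add h1 h2))
    (by positivity)).trans_eq ?_
  field_simp
  ring

theorem lineDiff_eq [CompleteSpace E] {g : ℂ → E} {d d' x₀ K : ℝ} (hd0 : 0 ≤ d) (hdd : d ≤ d')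
    (hd : ∀ u : ℂ, d ≤ |u.im| → |u.im| ≤ d' → DifferentiableAt ℂ g u)
    (hb : ∀ u : ℂ, d ≤ |u.im| → |u.im| ≤ d' → ‖g u‖ ≤ K * (Real.cosh ((u.re - x₀) / 2))⁻¹) :
    lineDiff d g = lineDiff d' g := by
  have h1 : ∀ y ∈ uIcc (-d) (-d'), d ≤ |y| ∧ |y| ≤ d' := by
    intro y hy
    rw [uIcc_of_ge (neg_le_neg hdd)] at hy
    rw [abs_of_nonpos (by linarith [hy.2])]
    exact ⟨by linarith [hy.2], by linarith [hy.1]⟩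
  have h2 : ∀ y ∈ uIcc d d', d ≤ |y| ∧ |y| ≤ d' := by
    intro y hy
    rw [uIcc_of_le hdd] at hy
    rwa [abs_of_nonneg (by linarith [hy.1])]
  simp only [lineDiff]
  rw [integral_line_eq (fun u hu => hd u (h1 _ hu).1 (h1 _ hu).2)
      fun u hu => hb u (h1 _ hu).1 (h1 _ hu).2,
    integral_line_eq (fun u hu => hd u (h2 _ hu).1 (h2 _ hu).2)
      fun u hu => hb u (h2 _ hu).1 (h2 _ hu).2]

theorem mul_lineDiff {𝓐 : Type*} [NormedRing 𝓐] [NormedAlgebra ℂ 𝓐] [CompleteSpace 𝓐] {d : ℝ}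
    {g : ℂ → 𝓐} (hg : LineIntegrable d g) (c : 𝓐) :
    c * lineDiff d g = lineDiff d fun u => c * g u := by
  simp only [lineDiff]
  rw [integral_const_mul_of_integrable hg.1, integral_const_mul_of_integrable hg.2, ← mul_sub,
    mul_smul_comm]

theorem commute_lineDiff {𝓐 : Type*} [NormedRing 𝓐] [NormedAlgebra ℂ 𝓐] [CompleteSpace 𝓐] {d : ℝ}
    {g : ℂ → 𝓐} (hd0 : 0 ≤ d) (hg : LineIntegrable d g) {c : 𝓐}
    (hc : ∀ u : ℂ, |u.im| = d → Commute c (g u)) : Commute c (lineDiff d g) := by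
  have h1 : c * lineDiff d g = lineDiff d fun u => g u * c := by
    rw [mul_lineDiff hg]
    exact lineDiff_congr hd0 fun u hu => (hc u hu).eq
  rw [Commute, SemiconjBy, h1]
  simp only [lineDiff]
  rw [integral_mul_const_of_integrable hg.1, integral_mul_const_of_integrable hg.2, ← sub_mul,
    smul_mul_assoc]

end

/-! ### The kernels of the square root -/

theorem sin_half_le_abs {a y : ℝ} (ha : 0 ≤ a) (h1 : a ≤ |y|) (h2 : |y| ≤ 2 * Real.pi - a) :
    Real.sin (a / 2) ≤ |Real.sin (y / 2)| := by
  have h3 : |Real.sin (y / 2)| = |Real.sin (|y| / 2)| := by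
    rcases abs_choice y with h | h <;> rw [h]
    rw [neg_div, Real.sin_neg, abs_neg]
  rw [h3]
  refine le_trans ?_ (le_abs_self _)
  rcases le_total (|y| / 2) (Real.pi / 2) with h | h
  · exact Real.sin_le_sin_of_le_of_le_pi_div_two (by linarith [Real.pi_pos]) h (by linarith)
  · rw [← Real.sin_pi_sub (|y| / 2)]
    exact Real.sin_le_sin_of_le_of_le_pi_div_two (by linarith [Real.pi_pos]) (by linarith)
      (by linarith)

theorem cos_half_le_abs {a y : ℝ} (h1 : |y| ≤ a) (h2 : a ≤ Real.pi) :
    Real.cos (a / 2) ≤ |Real.cos (y / 2)| := by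
  refine le_trans ?_ (le_abs_self _)
  rw [← Real.cos_abs (y / 2), abs_div, abs_two]
  exact Real.cos_le_cos_of_nonneg_of_le_pi (by positivity) (by linarith [Real.pi_pos])
    (by linarith)

theorem cosh_half_ne_zero {u : ℂ} (h : |u.im| < Real.pi) : Complex.cosh (u / 2) ≠ 0 := by
  have h1 := norm_cosh_ge (u / 2)
  have h2 : 0 < Real.cos (u.im / 2) := by
    rw [abs_lt] at h
    exact Real.cos_pos_of_mem_Ioo ⟨by linarith, by linarith⟩
  intro h0
  rw [h0, norm_zero] at h1
  simp only [Complex.div_ofNat_im, abs_of_pos h2] at h1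
  nlinarith [mul_pos h2 (Real.cosh_pos (u / 2).re)]

theorem norm_inv_cosh_le {u : ℂ} {a : ℝ} (h : |u.im| ≤ a) (ha : a < Real.pi) :
    ‖(2 * Complex.cosh (u / 2))⁻¹‖ ≤ (2 * Real.cos (a / 2))⁻¹ * (Real.cosh (u.re / 2))⁻¹ := by
  have h1 := norm_cosh_ge (u / 2)
  have h2 : 0 < Real.cos (a / 2) := by
    have := abs_nonneg u.im
    exact Real.cos_pos_of_mem_Ioo ⟨by linarith [Real.pi_pos], by linarith⟩
  have h3 := cos_half_le_abs h ha.le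
  simp only [Complex.div_ofNat_im, Complex.div_ofNat_re] at h1
  have h4 := Real.cosh_pos (u.re / 2)
  rw [norm_inv, norm_mul, Complex.norm_two, ← mul_inv, mul_assoc]
  refine inv_anti₀ (by positivity) ?_
  gcongr
  exact (mul_le_mul_of_nonneg_right h3 h4.le).trans h1

theorem norm_sinh_half_ge {u v : ℂ} {a : ℝ} (ha : 0 < a) (h1 : a ≤ |u.im - v.im|)
    (h2 : |u.im - v.im| ≤ 2 * Real.pi - a) :
    Real.sin (a / 2) * Real.cosh ((u.re - v.re) / 2) ≤ ‖Complex.sinh ((u - v) / 2)‖ := by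
  have h3 := norm_sinh_ge ((u - v) / 2)
  simp only [Complex.div_ofNat_im, Complex.div_ofNat_re, Complex.sub_re, Complex.sub_im] at h3
  exact (mul_le_mul_of_nonneg_right (sin_half_le_abs ha.le h1 h2) (Real.cosh_pos _).le).trans h3

theorem sin_half_pos {a : ℝ} (ha : 0 < a) (h : a < 2 * Real.pi) : 0 < Real.sin (a / 2) :=
  Real.sin_pos_of_pos_of_lt_pi (by linarith) (by linarith)

theorem sinh_half_ne_zero {u v : ℂ} (h1 : 0 < |u.im - v.im|)
    (h2 : |u.im - v.im| < 2 * Real.pi) : Complex.sinh ((u - v) / 2) ≠ 0 := by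
  have h3 := norm_sinh_ge ((u - v) / 2)
  simp only [Complex.div_ofNat_im, Complex.div_ofNat_re, Complex.sub_re, Complex.sub_im] at h3
  intro h0
  rw [h0, norm_zero] at h3
  have h4 : 0 < |Real.sin ((u.im - v.im) / 2)| := by
    have h5 := sin_half_pos h1 h2
    rcases abs_choice (u.im - v.im) with h | h
    · rw [h] at h5
      exact abs_pos.2 h5.ne'
    · rw [h, neg_div, Real.sin_neg] at h5
      exact abs_pos.2 (by linarith)
  nlinarith [mul_pos h4 (Real.cosh_pos ((u.re - v.re) / 2))]

theorem norm_inv_sinh_le {u v : ℂ} {a : ℝ} (ha : 0 < a) (h1 : a ≤ |u.im - v.im|)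
    (h2 : |u.im - v.im| ≤ 2 * Real.pi - a) :
    ‖(2 * Complex.sinh ((u - v) / 2))⁻¹‖ ≤
      (2 * Real.sin (a / 2))⁻¹ * (Real.cosh ((u.re - v.re) / 2))⁻¹ := by
  have h3 := norm_sinh_half_ge ha h1 h2
  have h4 := sin_half_pos ha (by linarith)
  have h5 := Real.cosh_pos ((u.re - v.re) / 2)
  rw [norm_inv, norm_mul, Complex.norm_two, ← mul_inv, mul_assoc]
  refine inv_anti₀ (by positivity) ?_
  gcongr

/-- `z^{1/2}/(1+z) · dz/z` has no pole in the sector `S_d`. -/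
theorem lineDiff_inv_cosh {d : ℝ} (h0 : 0 ≤ d) (hd : d < Real.pi) :
    lineDiff d (fun u : ℂ => (2 * Complex.cosh (u / 2))⁻¹) = 0 := by
  have h : lineDiff 0 (fun u : ℂ => (2 * Complex.cosh (u / 2))⁻¹)
      = lineDiff d (fun u : ℂ => (2 * Complex.cosh (u / 2))⁻¹) := by
    refine lineDiff_eq (x₀ := 0) (K := (2 * Real.cos (d / 2))⁻¹) le_rfl h0
      (fun u _ hu => ?_) fun u _ hu => ?_
    · refine DifferentiableAt.inv (by fun_prop) (mul_ne_zero two_ne_zero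
        (cosh_half_ne_zero (hu.trans_lt hd)))
    · simpa using norm_inv_cosh_le hu hd
  rw [← h, lineDiff]
  simp

theorem integral_inv_sinh_line (v : ℂ) {σ : ℝ} (hσ : σ = 1 ∨ σ = -1) :
    ∫ s : ℝ, (2 * Complex.sinh ((s + (v.im + σ * Real.pi : ℝ) * Complex.I - v) / 2))⁻¹ =
      -(σ * Real.pi * Complex.I) := by
  have h1 : ∀ s : ℝ, (2 * Complex.sinh ((s + (v.im + σ * Real.pi : ℝ) * Complex.I - v) / 2))⁻¹ =
      -(σ * Complex.I / 2) * ((Real.cosh ((s - v.re) / 2))⁻¹ : ℝ) := by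
    intro s
    have h2 : (s + (v.im + σ * Real.pi : ℝ) * Complex.I - v) / 2
        = ((s - v.re) / 2 : ℝ) + (σ * (Real.pi / 2) : ℝ) * Complex.I := by
      nth_rewrite 2 [← Complex.re_add_im v]
      push_cast
      ring
    have h3 : Complex.sinh ((s + (v.im + σ * Real.pi : ℝ) * Complex.I - v) / 2)
        = σ * Complex.I * (Real.cosh ((s - v.re) / 2) : ℝ) := by
      rw [h2, Complex.sinh_add, Complex.cosh_mul_I, Complex.sinh_mul_I, ← Complex.ofReal_cos,
        ← Complex.ofReal_sin, ← Complex.ofReal_cosh]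
      rcases hσ with rfl | rfl <;> simp <;> ring
    have h4 : ((Real.cosh ((s - v.re) / 2) : ℝ) : ℂ) ≠ 0 :=
      Complex.ofReal_ne_zero.2 (Real.cosh_pos _).ne'
    rw [h3, Complex.ofReal_inv]
    have h6 : (σ : ℂ) * σ = 1 := by rcases hσ with rfl | rfl <;> simp
    have h5 : (σ : ℂ) ≠ 0 := by rcases hσ with rfl | rfl <;> simp
    rw [inv_eq_iff_eq_inv]
    field_simp
    linear_combination ((σ : ℂ) ^ 2) * Complex.I_sq - h6
  simp only [h1]
  rw [integral_const_mul, integral_complex_ofReal, integral_sech]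
  push_cast
  ring

/-- The residue of `(2 sinh((u - v)/2))⁻¹` at `u = v` is one. Moving the two lines to
`Im u = Im v ∓ π`, where the kernel is `±i/2` times a hyperbolic secant, evaluates the integral. -/
theorem lineDiff_inv_sinh {d : ℝ} {v : ℂ} (hv : |v.im| < d) (hd : d < Real.pi) :
    lineDiff d (fun u : ℂ => (2 * Complex.sinh ((u - v) / 2))⁻¹) = 1 := by
  have hpi := Real.pi_pos
  have key : ∀ σ : ℝ, (σ = 1 ∨ σ = -1) →
      ∫ s : ℝ, (2 * Complex.sinh ((s + (σ * d : ℝ) * Complex.I - v) / 2))⁻¹ =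
        -(σ * Real.pi * Complex.I) := by
    intro σ hσ
    rw [← integral_inv_sinh_line v hσ]
    have hmain : ∀ y ∈ uIcc (σ * d) (v.im + σ * Real.pi), d - |v.im| ≤ |y - v.im| ∧
        |y - v.im| ≤ 2 * Real.pi - (d - |v.im|) := by
      intro y hy
      have ht1 := le_abs_self v.im
      have ht2 := neg_abs_le v.im
      rcases hσ with rfl | rfl
      · have h1 : d - |v.im| ≤ y - v.im ∧ y - v.im ≤ 2 * Real.pi - (d - |v.im|) := by
          rcases mem_uIcc.1 hy with h | h <;> constructor <;> linarith [h.1, h.2]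
        rwa [abs_of_nonneg (a := y - v.im) (by linarith)]
      · have h1 : d - |v.im| ≤ v.im - y ∧ v.im - y ≤ 2 * Real.pi - (d - |v.im|) := by
          rcases mem_uIcc.1 hy with h | h <;> constructor <;> linarith [h.1, h.2]
        rwa [abs_sub_comm y, abs_of_nonneg (a := v.im - y) (by linarith)]
    refine integral_line_eq (g := fun u : ℂ => (2 * Complex.sinh ((u - v) / 2))⁻¹) (x₀ := v.re)
      (K := (2 * Real.sin ((d - |v.im|) / 2))⁻¹) (fun u hu => ?_) fun u hu => ?_
    · obtain ⟨h1, h2⟩ := hmain _ hu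
      exact DifferentiableAt.inv (by fun_prop) (mul_ne_zero two_ne_zero
        (sinh_half_ne_zero (by linarith) (by linarith)))
    · obtain ⟨h1, h2⟩ := hmain _ hu
      exact norm_inv_sinh_le (by linarith) h1 h2
  have h1 := key 1 (Or.inl rfl)
  have h2 := key (-1) (Or.inr rfl)
  rw [one_mul] at h1
  rw [neg_one_mul] at h2
  rw [lineDiff, h1, h2, smul_eq_mul]
  have : (Real.pi : ℂ) ≠ 0 := Complex.ofReal_ne_zero.2 hpi.ne'
  have := Complex.I_ne_zero
  push_cast
  field_simp
  ring

end

section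
variable {X : Type*} [NormedAddCommGroup X] [NormedSpace ℂ X] {A : X →ₗ.[ℂ] X} {M : ℝ}

/-! ### The regularized square root -/

theorem SquareResolventBound.norm_expResolvent_le_of_im (h : SquareResolventBound A M) {u : ℂ}
    {a : ℝ} (ha : 0 < a) (h1 : a ≤ |u.im|) (h2 : |u.im| ≤ 2 * Real.pi - a) :
    ‖expResolvent A u‖ ≤ M / Real.sin (a / 2) := by
  have h3 := sin_half_le_abs ha.le h1 h2
  have h4 := sin_half_pos ha (by linarith)
  exact (h.norm_expResolvent_le (abs_pos.1 (h4.trans_le h3))).trans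
    (div_le_div_of_nonneg_left h.nonneg h4 h3)

theorem sin_half_im_ne_zero {u : ℂ} (h1 : 0 < |u.im|) (h2 : |u.im| < 2 * Real.pi) :
    Real.sin (u.im / 2) ≠ 0 :=
  abs_pos.1 ((sin_half_pos h1 h2).trans_le (by
    rcases abs_choice u.im with h | h <;> rw [h]
    · exact le_abs_self _
    · rw [neg_div, Real.sin_neg]; exact neg_le_abs _))

/-- The operator `T = (z^{1/2}/(1+z))(A) = A^{1/2}(1+A)⁻¹`, computed on `∂S_d`, in the logarithmic
coordinate. -/
def sqrtRegularized (A : X →ₗ.[ℂ] X) (d : ℝ) : X →L[ℂ] X :=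
  lineDiff d fun u => (2 * Complex.cosh (u / 2))⁻¹ • expResolvent A u

theorem integral_Ioi_eq_integral_exp {E : Type*} [NormedAddCommGroup E] [NormedSpace ℝ E]
    (f : ℝ → E) : ∫ r in Ioi (0 : ℝ), f r = ∫ s : ℝ, Real.exp s • f (Real.exp s) := by
  have := integral_image_eq_integral_abs_deriv_smul (s := univ) (f := Real.exp) MeasurableSet.univ
    (fun x _ => (Real.hasDerivAt_exp x).hasDerivWithinAt) Real.exp_injective.injOn f
  rw [image_univ, Real.range_exp] at this
  simpa using this

theorem contourIntegral_eq_sqrtRegularized (A : X →ₗ.[ℂ] X) {d : ℝ} (h0 : 0 < d)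
    (hd : d < Real.pi) :
    contourIntegral A d (fun z => z ^ (1 / 2 : ℂ) / (1 + z)) = sqrtRegularized A d := by
  have hline : ∀ c : ℝ, |c| < Real.pi →
      ∫ r in Ioi (0 : ℝ), (((r * Complex.exp (c * Complex.I)) ^ (1 / 2 : ℂ) /
          (1 + r * Complex.exp (c * Complex.I))) * Complex.exp (c * Complex.I)) •
          resolvent A (r * Complex.exp (c * Complex.I)) =
        ∫ s : ℝ, (2 * Complex.cosh ((s + c * Complex.I) / 2))⁻¹ •
          expResolvent A (s + c * Complex.I) := by
    intro c hc
    rw [integral_Ioi_eq_integral_exp]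
    congr 1
    ext1 s
    have he : (Real.exp s : ℂ) * Complex.exp (c * Complex.I) = Complex.exp (s + c * Complex.I) := by
      rw [Complex.exp_add, Complex.ofReal_exp]
    rw [he, expResolvent, smul_smul, ← Complex.coe_smul, smul_smul]
    congr 1
    set u : ℂ := s + c * Complex.I with hu
    have him : u.im = c := by simp [hu]
    have hpow : Complex.exp u ^ (1 / 2 : ℂ) = Complex.exp (u / 2) := by
      rw [Complex.cpow_def_of_ne_zero (Complex.exp_ne_zero _), Complex.log_exp]
      · ring_nf
      · rw [him]; exact (abs_lt.1 hc).1
      · rw [him]; exact (abs_lt.1 hc).2.le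
    have hcosh := cosh_half_ne_zero (u := u) (by rwa [him])
    have hsq : Complex.exp u = Complex.exp (u / 2) ^ 2 := by
      rw [← Complex.exp_nat_mul]; congr 1; push_cast; ring
    have hne := Complex.exp_ne_zero (u / 2)
    have hc2 : 2 * Complex.cosh (u / 2) * Complex.exp (u / 2) = 1 + Complex.exp u := by
      rw [Complex.cosh, Complex.exp_neg, hsq]
      field_simp
      ring
    have h1 : 1 + Complex.exp u ≠ 0 := by
      rw [← hc2]
      exact mul_ne_zero (mul_ne_zero two_ne_zero hcosh) hne
    calc (Real.exp s : ℂ) * (Complex.exp u ^ (1 / 2 : ℂ) / (1 + Complex.exp u) *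
          Complex.exp (c * Complex.I))
        = Complex.exp u * (Complex.exp (u / 2) / (1 + Complex.exp u)) := by
          rw [hpow, ← he]; ring
      _ = (2 * Complex.cosh (u / 2))⁻¹ * Complex.exp u := by
          rw [← hc2]
          field_simp
  have hd' : |d| < Real.pi := by rwa [abs_of_pos h0]
  have h1 := hline d hd'
  have h2 := hline (-d) (by rwa [abs_neg])
  rw [contourIntegral, sqrtRegularized, lineDiff, ← h1, ← h2]
  simp only [Complex.ofReal_neg, neg_mul]

theorem SquareResolventBound.norm_cosh_smul_le (h : SquareResolventBound A M) {d d' : ℝ} {u : ℂ}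
    (h0 : 0 < d) (hd' : d' < Real.pi) (h1 : d ≤ |u.im|) (h2 : |u.im| ≤ d') :
    ‖(2 * Complex.cosh (u / 2))⁻¹ • expResolvent A u‖ ≤
      (2 * Real.cos (d' / 2))⁻¹ * (M / Real.sin (d / 2)) * (Real.cosh ((u.re - 0) / 2))⁻¹ := by
  have h3 := norm_inv_cosh_le h2 hd'
  have h4 := h.norm_expResolvent_le_of_im h0 h1 (by linarith)
  rw [norm_smul, sub_zero, mul_right_comm]
  exact mul_le_mul h3 h4 (norm_nonneg _) ((norm_nonneg _).trans h3)


theorem inv_cosh_differentiableAt {u : ℂ} (h : |u.im| < Real.pi) :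
    DifferentiableAt ℂ (fun u : ℂ => (2 * Complex.cosh (u / 2))⁻¹) u :=
  DifferentiableAt.inv (by fun_prop) (mul_ne_zero two_ne_zero (cosh_half_ne_zero h))

theorem SquareResolventBound.differentiableAt_cosh_smul [CompleteSpace X]
    (h : SquareResolventBound A M) {u : ℂ}
    (h1 : 0 < |u.im|) (h2 : |u.im| < Real.pi) :
    DifferentiableAt ℂ (fun u => (2 * Complex.cosh (u / 2))⁻¹ • expResolvent A u) u :=
  (inv_cosh_differentiableAt h2).smul
    (h.differentiableAt_expResolvent (sin_half_im_ne_zero h1 (by linarith)))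

theorem SquareResolventBound.sqrtRegularized_eq_of_le [CompleteSpace X]
    (h : SquareResolventBound A M) {d d' : ℝ}
    (h0 : 0 < d) (hdd : d ≤ d') (hd' : d' < Real.pi) :
    sqrtRegularized A d = sqrtRegularized A d' :=
  lineDiff_eq h0.le hdd
    (fun _ h1 h2 => h.differentiableAt_cosh_smul (h0.trans_le h1) (h2.trans_lt hd'))
    fun _ h1 h2 => h.norm_cosh_smul_le h0 hd' h1 h2

theorem SquareResolventBound.sqrtRegularized_eq [CompleteSpace X]
    (h : SquareResolventBound A M) {d d' : ℝ}
    (h0 : 0 < d) (hd : d < Real.pi) (h0' : 0 < d') (hd' : d' < Real.pi) :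
    sqrtRegularized A d = sqrtRegularized A d' := by
  rcases le_total d d' with hdd | hdd
  · exact h.sqrtRegularized_eq_of_le h0 hdd hd'
  · exact (h.sqrtRegularized_eq_of_le h0' hdd hd).symm

theorem SquareResolventBound.lineIntegrable_cosh_smul [CompleteSpace X]
    (h : SquareResolventBound A M) {d : ℝ}
    (h0 : 0 < d) (hd : d < Real.pi) :
    LineIntegrable d fun u => (2 * Complex.cosh (u / 2))⁻¹ • expResolvent A u :=
  lineIntegrable_of_bound h0.le
    (fun _ hu => (h.differentiableAt_cosh_smul (hu.symm ▸ h0) (hu.symm ▸ hd)).continuousAt)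
    fun _ hu => h.norm_cosh_smul_le h0 hd hu.ge hu.le

theorem SquareResolventBound.commute_sqrtRegularized [CompleteSpace X]
    (h : SquareResolventBound A M) {d : ℝ}
    (h0 : 0 < d) (hd : d < Real.pi) {S : X →L[ℂ] X}
    (hS : ∀ z : ℂ, -z ∈ Complex.slitPlane → Commute S (resolvent A z)) :
    Commute S (sqrtRegularized A d) :=
  commute_lineDiff h0.le (h.lineIntegrable_cosh_smul h0 hd) fun u hu =>
    ((hS _ (neg_exp_mem_slitPlane
      (sin_half_im_ne_zero (hu.symm ▸ h0) (by rw [hu]; linarith)))).smul_right _).smul_right _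

/-! ### The resolvent of the square root in the left half-plane -/

/-- The Cauchy integral `(2πi)⁻¹ ∫ (2 sinh((u - v)/2))⁻¹ e^u R(e^u, A) du` over the lines
`Im u = ∓d`. With `l = e^{v/2}` and `|Im v| < d` it turns out to be `l (l + A^{1/2})⁻¹`: for
`z = e^u`, the kernel is `-l z^{1/2}/(l² - z)`, the part odd in `z^{1/2}` of the function
`l/(l + z^{1/2})`. It is holomorphic in `v` across the real axis, where `e^v` meets `σ(A)`. -/
def sqrtResolvent (A : X →ₗ.[ℂ] X) (d : ℝ) (v : ℂ) : X →L[ℂ] X :=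
  lineDiff d fun u => (2 * Complex.sinh ((u - v) / 2))⁻¹ • expResolvent A u

theorem im_sub_im_mem {u v : ℂ} {b d : ℝ} (hd : d < Real.pi) (hu : |u.im| = d)
    (hv : |v.im| ≤ b) : d - b ≤ |u.im - v.im| ∧ |u.im - v.im| ≤ 2 * Real.pi - (d - b) := by
  constructor
  · have := abs_sub_abs_le_abs_sub u.im v.im
    linarith
  · have := abs_sub u.im v.im
    linarith

theorem SquareResolventBound.norm_sinh_smul_le (h : SquareResolventBound A M) {b d : ℝ} {u v : ℂ}
    (h0 : 0 < d) (hd : d < Real.pi) (hb : b < d) (hu : |u.im| = d) (hv : |v.im| ≤ b) :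
    ‖(2 * Complex.sinh ((u - v) / 2))⁻¹ • expResolvent A u‖ ≤
      (2 * Real.sin ((d - b) / 2))⁻¹ * (M / Real.sin (d / 2)) *
        (Real.cosh ((u.re - v.re) / 2))⁻¹ := by
  obtain ⟨h1, h2⟩ := im_sub_im_mem hd hu hv
  have h3 := norm_inv_sinh_le (by linarith) h1 h2
  have h4 := h.norm_expResolvent_le_of_im h0 hu.ge (by linarith)
  rw [norm_smul, mul_right_comm]
  exact mul_le_mul h3 h4 (norm_nonneg _) ((norm_nonneg _).trans h3)

theorem inv_sinh_differentiableAt {u v : ℂ} (h1 : 0 < |u.im - v.im|)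
    (h2 : |u.im - v.im| < 2 * Real.pi) :
    DifferentiableAt ℂ (fun u : ℂ => (2 * Complex.sinh ((u - v) / 2))⁻¹) u :=
  DifferentiableAt.inv (by fun_prop) (mul_ne_zero two_ne_zero (sinh_half_ne_zero h1 h2))

theorem SquareResolventBound.lineIntegrable_sinh_smul [CompleteSpace X]
    (h : SquareResolventBound A M) {d : ℝ}
    (h0 : 0 < d) (hd : d < Real.pi) {v : ℂ} (hv : |v.im| < d) :
    LineIntegrable d fun u => (2 * Complex.sinh ((u - v) / 2))⁻¹ • expResolvent A u := by
  refine lineIntegrable_of_bound h0.le (fun u hu => ?_)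
    fun u hu => h.norm_sinh_smul_le h0 hd hv hu le_rfl
  obtain ⟨h1, h2⟩ := im_sub_im_mem hd hu (le_refl |v.im|)
  exact ((inv_sinh_differentiableAt (by linarith) (by linarith)).smul
    (h.differentiableAt_expResolvent (sin_half_im_ne_zero (hu.symm ▸ h0)
      (by rw [hu]; linarith)))).continuousAt

theorem SquareResolventBound.norm_sqrtResolvent_le (h : SquareResolventBound A M) {b d : ℝ}
    (h0 : 0 < d) (hd : d < Real.pi) (hb : b < d) {v : ℂ} (hv : |v.im| ≤ b) :
    ‖sqrtResolvent A d v‖ ≤ 2 * ((2 * Real.sin ((d - b) / 2))⁻¹ * (M / Real.sin (d / 2))) :=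
  norm_lineDiff_le h0.le fun _ hu => h.norm_sinh_smul_le h0 hd hb hu hv

theorem SquareResolventBound.commute_sqrtResolvent [CompleteSpace X]
    (h : SquareResolventBound A M) {d : ℝ}
    (h0 : 0 < d) (hd : d < Real.pi) {v : ℂ} (hv : |v.im| < d) {S : X →L[ℂ] X}
    (hS : ∀ z : ℂ, -z ∈ Complex.slitPlane → Commute S (resolvent A z)) :
    Commute S (sqrtResolvent A d v) :=
  commute_lineDiff h0.le (h.lineIntegrable_sinh_smul h0 hd hv) fun u hu =>
    ((hS _ (neg_exp_mem_slitPlane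
      (sin_half_im_ne_zero (hu.symm ▸ h0) (by rw [hu]; linarith)))).smul_right _).smul_right _

/-- Partial fractions for the product of the resolvents at `b²` and `a²`, with the kernels of
`sqrtRegularized` and `sqrtResolvent` written in terms of `a = e^{u/2}` and `b = e^{v/2}`. -/
theorem resolvent_partial_fractions {𝓐 : Type*} [Ring 𝓐] [Algebra ℂ 𝓐] {a b : ℂ} {R S : 𝓐}
    (ha : a ≠ 0) (hb : b ≠ 0) (hab : a ^ 2 - b ^ 2 ≠ 0) (ha1 : a ^ 2 + 1 ≠ 0)
    (h : R - S = (a ^ 2 - b ^ 2) • (R * S)) :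
    (b • ((1 + b ^ 2) • R - 1)) * ((a + a⁻¹)⁻¹ • a ^ 2 • S) =
      (a / b - b / a)⁻¹ • (b ^ 2 • R) + (b * (a + a⁻¹)⁻¹) • R -
        (a / b - b / a)⁻¹ • a ^ 2 • S := by
  have hS : S = R - (a ^ 2 - b ^ 2) • (R * S) := by rw [← h]; abel
  have h1 : (a + a⁻¹)⁻¹ = a / (a ^ 2 + 1) := by field_simp
  have h2 : (a / b - b / a)⁻¹ = a * b / (a ^ 2 - b ^ 2) := by field_simp
  rw [h1, h2]
  simp only [smul_mul_assoc, mul_smul_comm, sub_mul, one_mul]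
  generalize R * S = P at *
  rw [hS]
  match_scalars <;> field_simp <;> ring

theorem SquareResolventBound.mul_cosh_smul_eq (h : SquareResolventBound A M) {d : ℝ}
    (hd : d < Real.pi) {u v : ℂ} (hv0 : 0 < |v.im|) (hv : |v.im| < d) (hu : |u.im| = d) :
    (Complex.exp (v / 2) • ((1 + Complex.exp v) • resolvent A (Complex.exp v) - 1)) *
        ((2 * Complex.cosh (u / 2))⁻¹ • expResolvent A u) =
      (2 * Complex.sinh ((u - v) / 2))⁻¹ • expResolvent A v +
        (Complex.exp (v / 2) * (2 * Complex.cosh (u / 2))⁻¹) • resolvent A (Complex.exp v) -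
        (2 * Complex.sinh ((u - v) / 2))⁻¹ • expResolvent A u := by
  have h0 : 0 < d := hv0.trans hv
  set R := resolvent A (Complex.exp v) with hR
  have hRv : IsResolventAt A (Complex.exp v) R :=
    h.isResolventAt (neg_exp_mem_slitPlane (sin_half_im_ne_zero hv0 (by linarith)))
  have hsq : ∀ u : ℂ, Complex.exp u = Complex.exp (u / 2) ^ 2 := fun u => by
    rw [← Complex.exp_nat_mul]; congr 1; push_cast; ring
  obtain ⟨h1, h2⟩ := im_sub_im_mem hd hu (le_refl |v.im|)
  have hs := sinh_half_ne_zero (u := u) (v := v) (by linarith) (by linarith)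
  have hc := cosh_half_ne_zero (u := u) (by linarith)
  have hRu : IsResolventAt A (Complex.exp u) (resolvent A (Complex.exp u)) :=
    h.isResolventAt (neg_exp_mem_slitPlane
      (sin_half_im_ne_zero (hu.symm ▸ h0) (by rw [hu]; linarith)))
  have hid := hRv.sub_eq hRu
  have ea := Complex.exp_ne_zero (u / 2)
  have eb := Complex.exp_ne_zero (v / 2)
  have hcosh : 2 * Complex.cosh (u / 2) = Complex.exp (u / 2) + (Complex.exp (u / 2))⁻¹ := by
    rw [Complex.cosh, Complex.exp_neg]; ring
  have hsinh : 2 * Complex.sinh ((u - v) / 2) =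
      Complex.exp (u / 2) / Complex.exp (v / 2) - Complex.exp (v / 2) / Complex.exp (u / 2) := by
    rw [Complex.sinh, ← Complex.exp_sub, ← Complex.exp_sub]; ring_nf
  have hs' := mul_ne_zero two_ne_zero hs
  have hc' := mul_ne_zero two_ne_zero hc
  rw [hcosh] at hc'
  rw [hsinh] at hs'
  rw [expResolvent, expResolvent, ← hR, hcosh, hsinh]
  rw [hsq u, hsq v] at hid ⊢
  refine resolvent_partial_fractions ea eb (fun h0 => hs' ?_) (fun h0 => hc' ?_) hid
  · field_simp
    rw [mul_zero]
    exact h0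
  · field_simp
    rw [mul_zero]
    exact h0

/-- The resolvent of `A` splits as `2l R(l², A) = R(l, A^{1/2}) + (l + A^{1/2})⁻¹`; here this is the
identity `l A^{1/2} R(l², A) = l² R(l², A) - l (l + A^{1/2})⁻¹` with `l = e^{v/2}`. It comes from
the residue of the kernel at `u = v`. -/
theorem SquareResolventBound.exp_smul_eq [CompleteSpace X]
    (h : SquareResolventBound A M) {d : ℝ}
    (hd : d < Real.pi) {v : ℂ} (hv0 : 0 < |v.im|) (hv : |v.im| < d) :
    Complex.exp (v / 2) • ((1 + Complex.exp v) • (resolvent A (Complex.exp v) *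
      sqrtRegularized A d) - sqrtRegularized A d) = expResolvent A v - sqrtResolvent A d v := by
  have h0 : 0 < d := hv0.trans hv
  have hcs : LineIntegrable d fun u : ℂ => (2 * Complex.sinh ((u - v) / 2))⁻¹ :=
    lineIntegrable_of_bound (x₀ := v.re) (K := (2 * Real.sin ((d - |v.im|) / 2))⁻¹) h0.le
      (fun u hu => by
        obtain ⟨h1, h2⟩ := im_sub_im_mem hd hu (le_refl |v.im|)
        exact (inv_sinh_differentiableAt (by linarith) (by linarith)).continuousAt)
      (fun u hu => by
        obtain ⟨h1, h2⟩ := im_sub_im_mem hd hu (le_refl |v.im|)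
        exact norm_inv_sinh_le (by linarith) h1 h2)
  have hcc : LineIntegrable d fun u : ℂ => (2 * Complex.cosh (u / 2))⁻¹ :=
    lineIntegrable_of_bound (x₀ := 0) (K := (2 * Real.cos (d / 2))⁻¹) h0.le
      (fun u hu => (inv_cosh_differentiableAt (hu.symm ▸ hd)).continuousAt)
      (fun u hu => by simpa using norm_inv_cosh_le hu.le hd)
  set R := resolvent A (Complex.exp v)
  have hT := mul_lineDiff (h.lineIntegrable_cosh_smul h0 hd)
    (Complex.exp (v / 2) • ((1 + Complex.exp v) • R - 1))
  rw [lineDiff_congr h0.le fun u hu => h.mul_cosh_smul_eq hd hv0 hv hu] at hT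
  have i₁ : LineIntegrable d fun u : ℂ => (2 * Complex.sinh ((u - v) / 2))⁻¹ • expResolvent A v :=
    ⟨hcs.1.smul_const _, hcs.2.smul_const _⟩
  have i₂ : LineIntegrable d fun u : ℂ =>
      (Complex.exp (v / 2) * (2 * Complex.cosh (u / 2))⁻¹) • R :=
    ⟨(hcc.1.const_mul _).smul_const _, (hcc.2.const_mul _).smul_const _⟩
  have h₁ : lineDiff d (fun u : ℂ => (2 * Complex.sinh ((u - v) / 2))⁻¹ • expResolvent A v) =
      expResolvent A v := by
    rw [lineDiff_smul_const, lineDiff_inv_sinh hv hd, one_smul]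
  have h₂ : lineDiff d (fun u : ℂ =>
      (Complex.exp (v / 2) * (2 * Complex.cosh (u / 2))⁻¹) • R) = 0 := by
    rw [lineDiff_smul_const]
    have := lineDiff_const_smul d (Complex.exp (v / 2)) fun u : ℂ => (2 * Complex.cosh (u / 2))⁻¹
    rw [lineDiff_inv_cosh h0.le hd, smul_zero] at this
    simp only [smul_eq_mul] at this
    rw [this, zero_smul]
  have h₃ := lineDiff_sub (i₁.add i₂) (h.lineIntegrable_sinh_smul h0 hd hv)
  have h₄ := lineDiff_add i₁ i₂
  rw [h₁, h₂, add_zero] at h₄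
  refine Eq.trans ?_ ((hT.trans h₃).trans (congrArg (· - sqrtResolvent A d v) h₄))
  rw [sqrtRegularized, smul_mul_assoc, sub_mul, one_mul, smul_mul_assoc]

theorem cosh_le_exp_mul_cosh (x y : ℝ) : Real.cosh x ≤ Real.exp |x - y| * Real.cosh y := by
  have h1 : Real.exp x ≤ Real.exp |x - y| * Real.exp y := by
    rw [← Real.exp_add]
    exact Real.exp_le_exp.2 (by linarith [le_abs_self (x - y)])
  have h2 : Real.exp (-x) ≤ Real.exp |x - y| * Real.exp (-y) := by
    rw [← Real.exp_add]
    exact Real.exp_le_exp.2 (by linarith [neg_le_abs (x - y)])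
  rw [Real.cosh_eq, Real.cosh_eq]
  linarith

theorem SquareResolventBound.differentiableAt_integral_sinh_smul [CompleteSpace X]
    (h : SquareResolventBound A M)
    {c d : ℝ} (hcd : |c| = d) (h0 : 0 < d) (hd : d < Real.pi) {v : ℂ} (hv : |v.im| < d) :
    DifferentiableAt ℂ (fun v : ℂ => ∫ s : ℝ,
      (2 * Complex.sinh ((s + c * Complex.I - v) / 2))⁻¹ • expResolvent A (s + c * Complex.I))
      v := by
  obtain ⟨b, hvb, hbd⟩ := exists_between hv
  have him : ∀ s : ℝ, |((s : ℂ) + c * Complex.I).im| = d := fun s => by simpa using hcd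
  have hre : ∀ s : ℝ, ((s : ℂ) + c * Complex.I).re = s := fun s => by simp
  have hs : {w : ℂ | |w.im| < b ∧ |w.re - v.re| < 2} ∈ 𝓝 v := by
    have h1 : Continuous fun w : ℂ => |w.im| := Complex.continuous_im.abs
    have h2 : Continuous fun w : ℂ => |w.re - v.re| :=
      (Complex.continuous_re.sub continuous_const).abs
    exact ((isOpen_lt h1 continuous_const).inter (isOpen_lt h2 continuous_const)).mem_nhds
      ⟨hvb, by simp⟩
  have hint : ∀ w : ℂ, |w.im| < d → Integrable fun s : ℝ =>
      (2 * Complex.sinh ((s + c * Complex.I - w) / 2))⁻¹ • expResolvent A (s + c * Complex.I) := by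
    intro w hw
    have := h.lineIntegrable_sinh_smul h0 hd hw
    rcases abs_choice c with hc | hc
    · rw [← hc, hcd]; exact this.2
    · rw [show c = -d by linarith]; exact this.1
  have hcH : Continuous fun s : ℝ => expResolvent A (s + c * Complex.I) := by
    refine continuous_iff_continuousAt.2 fun s => ContinuousAt.comp
      (f := fun s : ℝ => (s + c * Complex.I : ℂ)) (h.differentiableAt_expResolvent
        (sin_half_im_ne_zero ?_ ?_)).continuousAt (by fun_prop)
    · rwa [him]
    · rw [him]; linarith
  have hsne : ∀ (s : ℝ) (w : ℂ), |w.im| < d →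
      Complex.sinh ((s + c * Complex.I - w) / 2) ≠ 0 := by
    intro s w hw
    obtain ⟨h1, h2⟩ := im_sub_im_mem hd (him s) (le_refl |w.im|)
    exact sinh_half_ne_zero (by linarith) (by linarith)
  set σ := Real.sin ((d - b) / 2)
  have hσ : 0 < σ := sin_half_pos (by linarith) (by linarith [abs_nonneg v.im])
  refine (hasDerivAt_integral_of_dominated_loc_of_deriv_le (μ := volume)
    (F := fun (w : ℂ) (s : ℝ) =>
      (2 * Complex.sinh ((s + c * Complex.I - w) / 2))⁻¹ • expResolvent A (s + c * Complex.I))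
    (F' := fun (w : ℂ) (s : ℝ) => (Complex.cosh ((s + c * Complex.I - w) / 2) /
      (2 * Complex.sinh ((s + c * Complex.I - w) / 2)) ^ 2) • expResolvent A (s + c * Complex.I))
    (bound := fun s => ((2 * σ) ^ 2)⁻¹ * Real.exp 1 * (M / Real.sin (d / 2)) *
      (Real.cosh ((s - v.re) / 2))⁻¹)
    hs ?_ (hint v hv) ?_ ?_ ?_ ?_).2.differentiableAt
  · filter_upwards [hs] with w hw using (hint w (hw.1.trans hbd)).aestronglyMeasurable
  · have h1 : Continuous fun s : ℝ => Complex.cosh ((s + c * Complex.I - v) / 2) := by fun_prop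
    have h2 : Continuous fun s : ℝ => (2 * Complex.sinh ((s + c * Complex.I - v) / 2)) ^ 2 := by
      fun_prop
    exact ((h1.div h2 fun s => pow_ne_zero _ (mul_ne_zero two_ne_zero
      (hsne s v hv))).smul hcH).aestronglyMeasurable
  · refine ae_of_all _ fun s w hw => ?_
    obtain ⟨h1, h2⟩ := im_sub_im_mem hd (him s) hw.1.le
    have h3 := norm_sinh_half_ge (by linarith) h1 h2
    have h4 := h.norm_expResolvent_le_of_im h0 (him s).ge (by rw [him]; linarith)
    have h5 := norm_cosh_le ((s + c * Complex.I - w) / 2)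
    rw [hre] at h3
    simp only [Complex.div_ofNat_re, Complex.sub_re, hre] at h5
    set k := Real.cosh ((s - w.re) / 2)
    set k₀ := Real.cosh ((s - v.re) / 2)
    have hk : 0 < k := Real.cosh_pos _
    have hk₀ : 0 < k₀ := Real.cosh_pos _
    have h6 : k₀ ≤ Real.exp 1 * k := by
      refine (cosh_le_exp_mul_cosh _ _).trans (mul_le_mul_of_nonneg_right
        (Real.exp_le_exp.2 ?_) hk.le)
      have h7 : (s - v.re) / 2 - (s - w.re) / 2 = (w.re - v.re) / 2 := by ring
      rw [h7, abs_div, abs_two]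
      linarith [hw.2]
    have h7 : ‖Complex.cosh ((s + c * Complex.I - w) / 2) /
        (2 * Complex.sinh ((s + c * Complex.I - w) / 2)) ^ 2‖ ≤
        ((2 * σ) ^ 2)⁻¹ * Real.exp 1 * k₀⁻¹ := by
      rw [norm_div, norm_pow, norm_mul, Complex.norm_two]
      calc _ ≤ k / (2 * (σ * k)) ^ 2 := by gcongr
        _ = ((2 * σ) ^ 2)⁻¹ * k⁻¹ := by field_simp
        _ ≤ ((2 * σ) ^ 2)⁻¹ * (Real.exp 1 * k₀⁻¹) := by
            gcongr
            rw [← div_eq_mul_inv, le_div_iff₀ hk₀, inv_mul_le_iff₀ hk, mul_comm k]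
            exact h6
        _ = _ := by ring
    rw [norm_smul, mul_right_comm]
    exact mul_le_mul h7 h4 (norm_nonneg _) (by positivity)
  · exact (integrable_sech v.re).const_mul _
  · refine ae_of_all _ fun s w hw => ?_
    have h1 : HasDerivAt (fun w : ℂ => (s + c * Complex.I - w) / 2) (-1 / 2) w :=
      ((hasDerivAt_id w).const_sub _).div_const 2
    have h2 := ((h1.csinh.const_mul 2).inv
      (mul_ne_zero two_ne_zero (hsne s w (hw.1.trans hbd)))).smul_const
      (expResolvent A (s + c * Complex.I))
    refine h2.congr_deriv ?_
    congr 2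
    ring

theorem SquareResolventBound.differentiableAt_sqrtResolvent [CompleteSpace X]
    (h : SquareResolventBound A M) {d : ℝ}
    (h0 : 0 < d) (hd : d < Real.pi) {v : ℂ} (hv : |v.im| < d) :
    DifferentiableAt ℂ (sqrtResolvent A d) v := by
  unfold sqrtResolvent lineDiff
  exact ((h.differentiableAt_integral_sinh_smul (by rw [abs_neg, abs_of_pos h0]) h0 hd hv).fun_sub
    (h.differentiableAt_integral_sinh_smul (abs_of_pos h0) h0 hd hv)).fun_const_smul _

end

section
/-! ### A Liouville theorem with a weak singularity -/

/-- A holomorphic function on `ℂ \ {0}` that is bounded at infinity and `O(|z|^{-1/2})` at the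
origin is constant: the singularity is removable, and Liouville's theorem applies. -/
theorem eq_of_norm_le_inv_sqrt {E : Type*} [NormedAddCommGroup E] [NormedSpace ℂ E]
    [CompleteSpace E] {F : ℂ → E} {K : ℝ} (hd : ∀ z ≠ 0, DifferentiableAt ℂ F z)
    (hb : ∀ z ≠ 0, ‖F z‖ ≤ K * (1 + (√‖z‖)⁻¹)) {z w : ℂ} (hz : z ≠ 0) (hw : w ≠ 0) :
    F z = F w := by
  have hK : 0 ≤ K := by
    have := (norm_nonneg _).trans (hb 1 one_ne_zero)
    simp only [norm_one, Real.sqrt_one, inv_one] at this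
    linarith
  have ho : (fun z => F z - F 0) =o[𝓝[≠] (0 : ℂ)] fun z => (z - 0)⁻¹ := by
    have h1 : Tendsto (fun z : ℂ => K * (‖z‖ + √‖z‖) + ‖F 0‖ * ‖z‖) (𝓝[≠] 0) (𝓝 0) := by
      have : Continuous fun z : ℂ => K * (‖z‖ + √‖z‖) + ‖F 0‖ * ‖z‖ := by fun_prop
      simpa using (this.tendsto 0).mono_left nhdsWithin_le_nhds
    refine Asymptotics.isLittleO_iff.2 fun c hc => ?_
    filter_upwards [h1.eventually (gt_mem_nhds hc), self_mem_nhdsWithin] with z h2 hz0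
    have hz0' : 0 < ‖z‖ := norm_pos_iff.2 hz0
    have hs : 0 < √‖z‖ := Real.sqrt_pos.2 hz0'
    rw [sub_zero, norm_inv, ← div_eq_mul_inv, le_div_iff₀ hz0']
    refine le_trans ?_ h2.le
    have h3 : (√‖z‖)⁻¹ * ‖z‖ = √‖z‖ := by
      rw [inv_mul_eq_div, Real.div_sqrt]
    calc ‖F z - F 0‖ * ‖z‖ ≤ (K * (1 + (√‖z‖)⁻¹) + ‖F 0‖) * ‖z‖ :=
          mul_le_mul_of_nonneg_right ((norm_sub_le _ _).trans (by gcongr; exact hb z hz0)) hz0'.le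
      _ = _ := by rw [add_mul, mul_assoc, add_mul, h3, one_mul]
  set G := Function.update F 0 (limUnder (𝓝[≠] (0 : ℂ)) F) with hG
  have hGd : Differentiable ℂ G := by
    rw [← differentiableOn_univ]
    exact Complex.differentiableOn_update_limUnder_of_isLittleO univ_mem
      (fun z hz => (hd z hz.2).differentiableWithinAt) ho
  have hGe : ∀ z ≠ 0, G z = F z := fun z hz => Function.update_of_ne hz _ _
  have hbdd : Bornology.IsBounded (range G) := by
    obtain ⟨R, hR⟩ := ((isCompact_closedBall (0 : ℂ) 1).image hGd.continuous).isBounded.exists_norm_le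
    refine isBounded_iff_forall_norm_le.2 ⟨max R (K * 2), ?_⟩
    rintro _ ⟨z, rfl⟩
    rcases le_total ‖z‖ 1 with h1 | h1
    · exact (hR _ ⟨z, by simpa using h1, rfl⟩).trans (le_max_left _ _)
    · have hz0 : z ≠ 0 := norm_pos_iff.1 (by linarith)
      rw [hGe z hz0]
      refine ((hb z hz0).trans ?_).trans (le_max_right _ _)
      have h2 : (√‖z‖)⁻¹ ≤ 1 := inv_le_one_of_one_le₀ (Real.one_le_sqrt.2 h1)
      exact mul_le_mul_of_nonneg_left (by linarith) hK
  rw [← hGe z hz, ← hGe w hw]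
  exact hGd.apply_eq_apply_of_bounded hbdd z w

variable {X : Type*} [NormedAddCommGroup X] [NormedSpace ℂ X] {A : X →ₗ.[ℂ] X} {M : ℝ}

/-! ### The square of the regularized square root -/

/-- The operator `J = (1 + A)⁻¹ = -R(-1, A)`. -/
def oneAddInv (A : X →ₗ.[ℂ] X) : X →L[ℂ] X := -resolvent A (-1)

/-- The operator `W(m) = A^{1/2} R(m, A)`, written as `(1 + A) R(m, A) T` with
`T = A^{1/2} (1 + A)⁻¹`. -/
def sqrtMulResolvent (A : X →ₗ.[ℂ] X) (d : ℝ) (m : ℂ) : X →L[ℂ] X :=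
  (1 + m) • (resolvent A m * sqrtRegularized A d) - sqrtRegularized A d

theorem SquareResolventBound.add_oneAddInv (h : SquareResolventBound A M) {m : ℂ}
    (hm : -m ∈ Complex.slitPlane) :
    (1 + m) • (resolvent A m * oneAddInv A) = resolvent A m + oneAddInv A := by
  have h1 := (h.isResolventAt hm).sub_eq (h.isResolventAt (z := -1) (by simp))
  rw [oneAddInv, ← sub_eq_add_neg, h1, mul_neg, smul_neg, ← neg_smul]
  congr 1
  ring

theorem SquareResolventBound.commute_resolvent (h : SquareResolventBound A M) {m m' : ℂ}
    (hm : -m ∈ Complex.slitPlane) (hm' : -m' ∈ Complex.slitPlane) :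
    Commute (resolvent A m) (resolvent A m') :=
  (h.isResolventAt hm).commute (h.isResolventAt hm')

theorem SquareResolventBound.commute_oneAddInv (h : SquareResolventBound A M) {m : ℂ}
    (hm : -m ∈ Complex.slitPlane) : Commute (oneAddInv A) (resolvent A m) :=
  (h.commute_resolvent (m := -1) (by simp) hm).neg_left

/-- The resolvent equation `R(m) - R(m') = (m' - m) R(m) R(m')`, multiplied by `A^{1/2}`. -/
theorem SquareResolventBound.sqrtMulResolvent_eq (h : SquareResolventBound A M) {d : ℝ}
    {m m' : ℂ} (hm : -m ∈ Complex.slitPlane) (hm' : -m' ∈ Complex.slitPlane) :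
    sqrtMulResolvent A d m =
      sqrtMulResolvent A d m' + (m' - m) • (resolvent A m * sqrtMulResolvent A d m') := by
  have h1 := (h.isResolventAt hm).sub_eq (h.isResolventAt hm')
  have h2 : (m' - m) • (resolvent A m * (resolvent A m' * sqrtRegularized A d)) =
      resolvent A m * sqrtRegularized A d - resolvent A m' * sqrtRegularized A d := by
    rw [← mul_assoc, ← smul_mul_assoc, ← h1, sub_mul]
  simp only [sqrtMulResolvent, mul_sub, mul_smul_comm, smul_sub]
  rw [smul_comm (m' - m), h2]
  module

/-- The operator `(1 + A) R(m, A) (J - J² - T²)`, which vanishes exactly if `T² = A (1 + A)⁻²`,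
in a form in which its size for small and large `m` can be read off. -/
def squareDefect (A : X →ₗ.[ℂ] X) (d : ℝ) (m : ℂ) : X →L[ℂ] X :=
  -(sqrtMulResolvent A d m * sqrtRegularized A d) + m • (resolvent A m * oneAddInv A) - oneAddInv A

variable [CompleteSpace X] {d : ℝ}

theorem SquareResolventBound.commute_resolvent_sqrtRegularized (h : SquareResolventBound A M)
    (h0 : 0 < d) (hd : d < Real.pi) {m : ℂ} (hm : -m ∈ Complex.slitPlane) :
    Commute (resolvent A m) (sqrtRegularized A d) :=
  h.commute_sqrtRegularized h0 hd fun _ hz => h.commute_resolvent hm hz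

theorem SquareResolventBound.commute_oneAddInv_sqrtRegularized (h : SquareResolventBound A M)
    (h0 : 0 < d) (hd : d < Real.pi) : Commute (oneAddInv A) (sqrtRegularized A d) :=
  h.commute_sqrtRegularized h0 hd fun _ hz => h.commute_oneAddInv hz

theorem SquareResolventBound.sqrtMulResolvent_mul_oneAddInv (h : SquareResolventBound A M)
    (h0 : 0 < d) (hd : d < Real.pi) {m : ℂ} (hm : -m ∈ Complex.slitPlane) :
    sqrtMulResolvent A d m * oneAddInv A = resolvent A m * sqrtRegularized A d := by
  have hc := h.commute_oneAddInv_sqrtRegularized h0 hd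
  rw [sqrtMulResolvent, sub_mul, smul_mul_assoc, mul_assoc, ← hc.eq, ← mul_assoc, ← smul_mul_assoc,
    h.add_oneAddInv hm, add_mul]
  abel

/-- Near the positive axis the singular part of the defect cancels: it is expressed by the
function `sqrtResolvent`, which is holomorphic across `(0, ∞)`. -/
theorem SquareResolventBound.squareDefect_exp (h : SquareResolventBound A M)
    (hd : d < Real.pi) {v : ℂ} (hv0 : 0 < |v.im|) (hv : |v.im| < d) :
    squareDefect A d (Complex.exp v) = sqrtResolvent A d v *
      (oneAddInv A + (Complex.exp (v / 2))⁻¹ • sqrtRegularized A d) - oneAddInv A := by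
  have h0 : 0 < d := hv0.trans hv
  have hm := neg_exp_mem_slitPlane (sin_half_im_ne_zero (u := v) hv0 (by linarith))
  have hWJ := h.sqrtMulResolvent_mul_oneAddInv h0 hd hm
  have hp : sqrtResolvent A d v = Complex.exp v • resolvent A (Complex.exp v) -
      Complex.exp (v / 2) • sqrtMulResolvent A d (Complex.exp v) := by
    have h1 := h.exp_smul_eq hd hv0 hv
    rw [sqrtMulResolvent, h1, expResolvent]
    abel
  have hsq : Complex.exp v = Complex.exp (v / 2) ^ 2 := by
    rw [← Complex.exp_nat_mul]; congr 1; push_cast; ring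
  have hne := Complex.exp_ne_zero (v / 2)
  rw [squareDefect, hp]
  generalize sqrtMulResolvent A d (Complex.exp v) = W at *
  generalize resolvent A (Complex.exp v) = R at *
  simp only [sub_mul, mul_add, smul_mul_assoc, mul_smul_comm, hWJ]
  rw [hsq]
  match_scalars <;> (field_simp; try ring)

open Classical in
/-- The defect `squareDefect`, continued holomorphically across `(0, ∞)`. -/
def holDefect (A : X →ₗ.[ℂ] X) (d : ℝ) (m : ℂ) : X →L[ℂ] X :=
  if -m ∈ Complex.slitPlane then squareDefect A d m else
    sqrtResolvent A d (Complex.log m) *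
      (oneAddInv A + (Complex.exp (Complex.log m / 2))⁻¹ • sqrtRegularized A d) - oneAddInv A

theorem arg_eq_zero_of_neg_notMem_slitPlane {m : ℂ} (hm : -m ∉ Complex.slitPlane) :
    Complex.arg m = 0 := by
  rw [neg_mem_slitPlane_iff, not_not] at hm
  obtain ⟨t, ht, rfl⟩ := hm
  exact Complex.arg_ofReal_of_nonneg ht

theorem SquareResolventBound.holDefect_eq (h : SquareResolventBound A M)
    (hd : d < Real.pi) {m : ℂ} (hm : m ≠ 0) (harg : |Complex.arg m| < d) :
    holDefect A d m = sqrtResolvent A d (Complex.log m) *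
      (oneAddInv A + (Complex.exp (Complex.log m / 2))⁻¹ • sqrtRegularized A d) -
        oneAddInv A := by
  rw [holDefect]
  split_ifs with hs
  · have h1 := h.squareDefect_exp hd (v := Complex.log m) ?_ (by rwa [Complex.log_im])
    · rw [← h1, Complex.exp_log hm]
    · rw [Complex.log_im, abs_pos]
      intro h0
      rw [neg_mem_slitPlane_iff] at hs
      refine hs ⟨‖m‖, norm_nonneg _, ?_⟩
      have := Complex.norm_mul_exp_arg_mul_I m
      rw [h0] at this
      simpa using this.symm
  · rfl

theorem SquareResolventBound.differentiableAt_holDefect (h : SquareResolventBound A M)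
    (hd : d < Real.pi) (hd2 : Real.pi / 2 < d) {m : ℂ} (hm : m ≠ 0) :
    DifferentiableAt ℂ (holDefect A d) m := by
  have h0 : 0 < d := by linarith [Real.pi_pos]
  by_cases hs : -m ∈ Complex.slitPlane
  · have h1 : holDefect A d =ᶠ[𝓝 m] squareDefect A d := by
      filter_upwards [(continuous_neg.isOpen_preimage _ Complex.isOpen_slitPlane).mem_nhds hs]
        with w hw
      exact if_pos hw
    refine DifferentiableAt.congr_of_eventuallyEq ?_ h1
    have hR := h.differentiableAt_resolvent hs
    unfold squareDefect sqrtMulResolvent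
    fun_prop
  · have hre : 0 < m.re := by
      rw [neg_mem_slitPlane_iff, not_not] at hs
      obtain ⟨t, ht, rfl⟩ := hs
      exact ht.lt_of_ne fun h => hm (by rw [← h, Complex.ofReal_zero])
    have hs' : m ∈ Complex.slitPlane := Or.inl hre
    have h1 : holDefect A d =ᶠ[𝓝 m] fun w => sqrtResolvent A d (Complex.log w) *
        (oneAddInv A + (Complex.exp (Complex.log w / 2))⁻¹ • sqrtRegularized A d) -
          oneAddInv A := by
      filter_upwards [(isOpen_lt continuous_const Complex.continuous_re).mem_nhds hre] with w hw
      refine h.holDefect_eq hd (fun h => ?_) ?_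
      · have hw' : 0 < w.re := hw
        simp [h] at hw'
      · exact (Complex.abs_arg_lt_pi_div_two_iff.2 (Or.inl hw)).trans hd2
    refine DifferentiableAt.congr_of_eventuallyEq ?_ h1
    have hlog := Complex.differentiableAt_log hs'
    have hp : DifferentiableAt ℂ (fun w => sqrtResolvent A d (Complex.log w)) m :=
      DifferentiableAt.comp m (g := sqrtResolvent A d) (h.differentiableAt_sqrtResolvent h0 hd
        (by rw [Complex.log_im, arg_eq_zero_of_neg_notMem_slitPlane hs, abs_zero]; exact h0)) hlog
    have he : DifferentiableAt ℂ (fun w => (Complex.exp (Complex.log w / 2))⁻¹) m :=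
      (hlog.div_const 2).cexp.inv (Complex.exp_ne_zero _)
    exact (hp.mul ((he.smul_const _).const_add _)).sub_const _

/-- The estimate for `W(m)` holds on the imaginary axis by the Cauchy integral, and the resolvent
equation carries it along the circle `|m| = const`. -/
theorem SquareResolventBound.exists_norm_sqrtMulResolvent_le (h : SquareResolventBound A M)
    (hd : d < Real.pi) (hd2 : Real.pi / 2 < d) :
    ∃ K : ℝ, 0 ≤ K ∧ ∀ u : ℂ, Real.sin (u.im / 2) ≠ 0 →
      ‖sqrtMulResolvent A d (Complex.exp u)‖ ≤
        K * Real.exp (-(u.re / 2)) * (1 + 2 * (M / |Real.sin (u.im / 2)|)) := by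
  have hpi := Real.pi_pos
  have h0 : 0 < d := by linarith
  refine ⟨M / Real.sin (Real.pi / 2 / 2) +
    2 * ((2 * Real.sin ((d - Real.pi / 2) / 2))⁻¹ * (M / Real.sin (d / 2))), ?_, fun u hu => ?_⟩
  · have h1 := h.nonneg
    have h2 := sin_half_pos (a := Real.pi / 2) (by linarith) (by linarith)
    have h3 := sin_half_pos (a := d - Real.pi / 2) (by linarith) (by linarith)
    have h4 := sin_half_pos (a := d) (by linarith) (by linarith)
    positivity
  set v : ℂ := u.re + (Real.pi / 2 : ℝ) * Complex.I with hv
  have hvre : v.re = u.re := by simp [hv]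
  have hvim : |v.im| = Real.pi / 2 := by
    simp only [hv, Complex.add_im, Complex.ofReal_im, Complex.im_ofReal_mul,
      Complex.I_im, mul_one, zero_add]
    exact abs_of_pos (by positivity)
  have hvs : Real.sin (v.im / 2) ≠ 0 :=
    sin_half_im_ne_zero (by rw [hvim]; linarith) (by rw [hvim]; linarith)
  have h1 := h.exp_smul_eq hd (v := v) (by rw [hvim]; linarith) (by rwa [hvim])
  have h2 : ‖sqrtMulResolvent A d (Complex.exp v)‖ ≤
      (M / Real.sin (Real.pi / 2 / 2) +
        2 * ((2 * Real.sin ((d - Real.pi / 2) / 2))⁻¹ * (M / Real.sin (d / 2)))) *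
        Real.exp (-(u.re / 2)) := by
    have h3 : ‖Complex.exp (v / 2) • sqrtMulResolvent A d (Complex.exp v)‖ ≤ _ :=
      (congrArg norm h1).trans_le ((norm_sub_le _ _).trans (add_le_add
        (h.norm_expResolvent_le_of_im (a := Real.pi / 2) (by linarith) hvim.ge
          (by rw [hvim]; linarith))
        (h.norm_sqrtResolvent_le h0 hd hd2 hvim.le)))
    rw [norm_smul, Complex.norm_exp, Complex.div_ofNat_re, hvre] at h3
    rw [Real.exp_neg, ← div_eq_mul_inv, le_div_iff₀ (Real.exp_pos _), mul_comm]
    exact h3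
  rw [h.sqrtMulResolvent_eq (d := d) (neg_exp_mem_slitPlane hu) (neg_exp_mem_slitPlane hvs)]
  have h4 := h.norm_expResolvent_le hu
  rw [expResolvent, norm_smul, Complex.norm_exp] at h4
  have h5 : ‖Complex.exp v - Complex.exp u‖ ≤ 2 * Real.exp u.re := by
    refine (norm_sub_le _ _).trans_eq ?_
    rw [Complex.norm_exp, Complex.norm_exp, hvre]
    ring
  calc _ ≤ ‖sqrtMulResolvent A d (Complex.exp v)‖ + ‖Complex.exp v - Complex.exp u‖ *
          (‖resolvent A (Complex.exp u)‖ * ‖sqrtMulResolvent A d (Complex.exp v)‖) := by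
        refine (norm_add_le _ _).trans (add_le_add_right ?_ _)
        rw [norm_smul]
        exact mul_le_mul_of_nonneg_left (norm_mul_le _ _) (norm_nonneg _)
    _ ≤ ‖sqrtMulResolvent A d (Complex.exp v)‖ + 2 * Real.exp u.re *
          (‖resolvent A (Complex.exp u)‖ * ‖sqrtMulResolvent A d (Complex.exp v)‖) := by gcongr
    _ = ‖sqrtMulResolvent A d (Complex.exp v)‖ *
          (1 + 2 * (Real.exp u.re * ‖resolvent A (Complex.exp u)‖)) := by ring
    _ ≤ _ := mul_le_mul h2 (by gcongr) (by positivity) ((norm_nonneg _).trans h2)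

theorem exp_neg_log_norm_half {m : ℂ} (hm : m ≠ 0) :
    Real.exp (-((Complex.log m).re / 2)) = (√‖m‖)⁻¹ := by
  rw [Complex.log_re, Real.exp_neg, Real.exp_half, Real.exp_log (norm_pos_iff.2 hm)]

theorem SquareResolventBound.exists_norm_holDefect_le (h : SquareResolventBound A M)
    (hd : d < Real.pi) (hd2 : Real.pi / 2 < d) :
    ∃ K : ℝ, ∀ m : ℂ, m ≠ 0 → ‖holDefect A d m‖ ≤ K * (1 + (√‖m‖)⁻¹) := by
  have hpi := Real.pi_pos
  have h0 : 0 < d := by linarith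
  obtain ⟨K, hK, hW⟩ := h.exists_norm_sqrtMulResolvent_le hd hd2
  have hM := h.nonneg
  set s := M / Real.sin (Real.pi / 2 / 2) with hs
  set p := 2 * ((2 * Real.sin ((d - Real.pi / 2) / 2))⁻¹ * (M / Real.sin (d / 2))) with hp
  set J := oneAddInv A with hJ
  set T := sqrtRegularized A d with hT
  have hs4 := sin_half_pos (a := Real.pi / 2) (by linarith) (by linarith)
  have hs0 : 0 ≤ s := by positivity
  have hp0 : 0 ≤ p := by
    have h3 := sin_half_pos (a := d - Real.pi / 2) (by linarith) (by linarith)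
    have h4 := sin_half_pos (a := d) (by linarith) (by linarith)
    positivity
  refine ⟨(p * (‖J‖ + ‖T‖) + ‖J‖) + (K * (1 + 2 * s) * ‖T‖ + s * ‖J‖ + ‖J‖), fun m hm => ?_⟩
  set q := (√‖m‖)⁻¹ with hq
  have hq0 : 0 ≤ q := by positivity
  have hj := norm_nonneg J
  have ht := norm_nonneg T
  rcases le_or_gt |Complex.arg m| (Real.pi / 2) with ha | ha
  · rw [h.holDefect_eq hd hm (ha.trans_lt hd2)]
    have h1 := h.norm_sqrtResolvent_le h0 hd hd2 (v := Complex.log m) (by rwa [Complex.log_im])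
    have h2 : ‖(Complex.exp (Complex.log m / 2))⁻¹‖ = q := by
      rw [norm_inv, Complex.norm_exp, Complex.div_ofNat_re, ← Real.exp_neg,
        exp_neg_log_norm_half hm]
    calc _ ≤ ‖sqrtResolvent A d (Complex.log m)‖ *
            (‖J‖ + ‖(Complex.exp (Complex.log m / 2))⁻¹‖ * ‖T‖) + ‖J‖ := by
          refine (norm_sub_le _ _).trans (add_le_add_left ((norm_mul_le _ _).trans ?_) _)
          refine mul_le_mul_of_nonneg_left ?_ (norm_nonneg _)
          exact (norm_add_le _ _).trans_eq (congrArg _ (norm_smul _ _))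
      _ ≤ p * (‖J‖ + q * ‖T‖) + ‖J‖ := by rw [h2]; gcongr
      _ ≤ (p * (‖J‖ + ‖T‖) + ‖J‖) * (1 + q) := by
          have e1 : 0 ≤ p * ‖T‖ := by positivity
          have e2 : 0 ≤ p * ‖J‖ * q := by positivity
          have e3 : 0 ≤ ‖J‖ * q := by positivity
          linarith
      _ ≤ _ := by
          refine mul_le_mul_of_nonneg_right (le_add_of_nonneg_right ?_) (by positivity)
          positivity
  · set u := Complex.log m with hu
    have hmu : Complex.exp u = m := Complex.exp_log hm
    have him : |u.im| = |Complex.arg m| := by rw [hu, Complex.log_im]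
    have hle := Complex.abs_arg_le_pi m
    have hsin : Real.sin (Real.pi / 2 / 2) ≤ |Real.sin (u.im / 2)| :=
      sin_half_le_abs (by linarith) (by rw [him]; exact ha.le) (by rw [him]; linarith)
    have hne : Real.sin (u.im / 2) ≠ 0 := abs_pos.1 (hs4.trans_le hsin)
    have hsl : -m ∈ Complex.slitPlane := hmu ▸ neg_exp_mem_slitPlane hne
    have hMs : M / |Real.sin (u.im / 2)| ≤ s := div_le_div_of_nonneg_left hM hs4 hsin
    have h1 := (h.norm_expResolvent_le hne).trans hMs
    have h2 := hW u hne
    rw [expResolvent, hmu] at h1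
    rw [hmu, exp_neg_log_norm_half hm] at h2
    have h3 : ‖sqrtMulResolvent A d m‖ ≤ K * q * (1 + 2 * s) :=
      h2.trans (mul_le_mul_of_nonneg_left (by gcongr) (by positivity))
    rw [holDefect, if_pos hsl, squareDefect, ← smul_mul_assoc]
    calc _ ≤ ‖sqrtMulResolvent A d m‖ * ‖T‖ + ‖m • resolvent A m‖ * ‖J‖ + ‖J‖ := by
          refine (norm_sub_le _ _).trans (add_le_add_left ((norm_add_le _ _).trans ?_) _)
          rw [norm_neg]
          exact add_le_add (norm_mul_le _ _) (norm_mul_le _ _)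
      _ ≤ K * q * (1 + 2 * s) * ‖T‖ + s * ‖J‖ + ‖J‖ := by gcongr
      _ ≤ (K * (1 + 2 * s) * ‖T‖ + s * ‖J‖ + ‖J‖) * (1 + q) := by
          have e1 : 0 ≤ K * (1 + 2 * s) * ‖T‖ := by positivity
          have e2 : 0 ≤ s * ‖J‖ * q := by positivity
          have e3 : 0 ≤ ‖J‖ * q := by positivity
          linarith
      _ ≤ _ := by
          refine mul_le_mul_of_nonneg_right (le_add_of_nonneg_left ?_) (by positivity)
          positivity

/-- The defect is constant by Liouville's theorem; comparing `m = -1` with `m = -2` shows that it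
vanishes. -/
theorem SquareResolventBound.holDefect_eq_zero (h : SquareResolventBound A M)
    (hd : d < Real.pi) (hd2 : Real.pi / 2 < d) {m : ℂ} (hm : m ≠ 0) : holDefect A d m = 0 := by
  have h0 : 0 < d := by linarith [Real.pi_pos]
  obtain ⟨K, hK⟩ := h.exists_norm_holDefect_le hd hd2
  have hconst : ∀ z : ℂ, z ≠ 0 → holDefect A d z = holDefect A d (-1) := fun z hz =>
    eq_of_norm_le_inv_sqrt (fun z hz => h.differentiableAt_holDefect hd hd2 hz) hK hz (by simp)
  have s1 : -(-1 : ℂ) ∈ Complex.slitPlane := by simp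
  have s2 : -(-2 : ℂ) ∈ Complex.slitPlane := Or.inl (by simp)
  have hR := h.isResolventAt s2
  have hRJ := h.add_oneAddInv s2
  set T := sqrtRegularized A d with hT
  set J := oneAddInv A with hJ
  set R := resolvent A (-2) with hRdef
  have e1 : holDefect A d (-1) = T * T + J * J - J := by
    rw [holDefect, if_pos s1, squareDefect, sqrtMulResolvent]
    have : resolvent A (-1) = -J := by rw [hJ, oneAddInv, neg_neg]
    rw [this, ← hT, ← hJ]
    simp
  have e2 : holDefect A d (-2) = (T * T + J * J - J) + R * (T * T + J * J - J) := by
    rw [holDefect, if_pos s2, squareDefect, sqrtMulResolvent, ← hT, ← hJ, ← hRdef]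
    have h3 : R * J = -(R + J) := by
      rw [← hRJ, ← neg_smul]
      norm_num
    have h4 : R * (J * J) = R + J - J * J := by
      rw [← mul_assoc, h3, neg_mul, add_mul, h3]
      abel
    have h5 : (1 + -2 : ℂ) = -1 := by norm_num
    rw [h5, mul_sub, mul_add, h4, h3, neg_one_smul, sub_mul, neg_mul, mul_assoc, neg_smul, two_smul]
    abel
  have h6 : R * (T * T + J * J - J) = R * 0 := by
    have := hconst (-2) (by simp)
    rw [e1, e2] at this
    rw [mul_zero]
    exact left_eq_add.1 this.symm
  rw [hconst m hm, e1]
  exact hR.mul_left_cancel h6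

end

section
variable {X : Type*} [NormedAddCommGroup X] [NormedSpace ℂ X] {A : X →ₗ.[ℂ] X} {M : ℝ}

/-! ### Resolvents of the square root -/

/-- Let `J = (1 + A)⁻¹` and `B = (1 + A) T`. If `Q` commutes with `J` and `T`, then `Q = R(z, B)` as
soon as `Q (z J - T) = J`, which is the identity `Q (z - B) = 1` with the unbounded factor `1 + A`
cleared. -/
theorem isResolventAt_oneAddComp {J T Q : X →L[ℂ] X} {z : ℂ} (hJ : IsResolventAt A (-1) (-J))
    (hQJ : Commute Q J) (hQT : Commute Q T) (h : Q * (z • J - T) = J) :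
    IsResolventAt (oneAddComp A T) z Q := by
  have hJ1 : ∀ x : X, ∃ hx : J x ∈ A.domain, J x + A ⟨J x, hx⟩ = x := by
    intro x
    obtain ⟨h1, h2⟩ := hJ.1 (-x)
    have h3 : (-J) (-x) = J x := by simp
    have h4 : J x ∈ A.domain := h3 ▸ h1
    have h5 : (⟨(-J) (-x), h1⟩ : A.domain) = ⟨J x, h4⟩ := Subtype.ext h3
    refine ⟨h4, ?_⟩
    rw [h5, h3, neg_one_smul, ← neg_add', neg_inj] at h2
    exact h2
  have hJ2 : ∀ y : A.domain, J ((y : X) + A y) = y := by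
    intro y
    have := hJ.2 y
    rwa [neg_one_smul, ← neg_add', map_neg, neg_apply, neg_neg] at this
  constructor
  · intro x
    have h1 : T (Q x) = J (z • Q x - x) := by
      have h2 := DFunLike.congr_fun h x
      rw [mul_sub, mul_smul_comm, hQJ.eq, hQT.eq] at h2
      simp only [sub_apply, smul_apply, mul_apply_eq_comp] at h2
      rw [map_sub, map_smul, ← h2]
      abel
    obtain ⟨h3, h4⟩ := hJ1 (z • Q x - x)
    have h5 : T (Q x) ∈ A.domain := h1 ▸ h3
    have h6 : (⟨T (Q x), h5⟩ : A.domain) = ⟨J (z • Q x - x), h3⟩ := Subtype.ext h1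
    refine ⟨h5, ?_⟩
    change z • Q x - (T (Q x) + A ⟨T (Q x), h5⟩) = x
    rw [h6, h1, h4]
    abel
  · intro y
    have h1 : J (oneAddComp A T y) = T y := hJ2 ⟨T y, y.2⟩
    have h2 : J (Q (z • (y : X) - oneAddComp A T y)) = J y := by
      have h3 := DFunLike.congr_fun h (y : X)
      have h4 := DFunLike.congr_fun hQJ.eq (z • (y : X) - oneAddComp A T y)
      simp only [sub_apply, smul_apply, mul_apply_eq_comp] at h3 h4
      rw [← h4, map_sub, map_smul, h1, h3]
    refine sub_eq_zero.1 (hJ.eq_zero ?_)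
    rw [neg_apply, map_sub, h2, sub_self, neg_zero]

variable {d : ℝ}

theorem SquareResolventBound.isResolventAt_neg_oneAddInv (h : SquareResolventBound A M) :
    IsResolventAt A (-1) (-oneAddInv A) := by
  rw [oneAddInv, neg_neg]
  exact h.isResolventAt (by simp)

/-- Off the real axis, `R(z, A^{1/2}) = (z + A^{1/2}) R(z², A)`. -/
theorem SquareResolventBound.isResolventAt_sqrt [CompleteSpace X]
    (h : SquareResolventBound A M)
    (hd : d < Real.pi) (hd2 : Real.pi / 2 < d) {z : ℂ} (hz : -z ^ 2 ∈ Complex.slitPlane) :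
    IsResolventAt (oneAddComp A (sqrtRegularized A d)) z
      (z • resolvent A (z ^ 2) + sqrtMulResolvent A d (z ^ 2)) := by
  have h0 : 0 < d := by linarith [Real.pi_pos]
  have hRT := h.commute_resolvent_sqrtRegularized h0 hd hz
  have hRJ := (h.commute_oneAddInv hz).symm
  have hTJ := (h.commute_oneAddInv_sqrtRegularized h0 hd).symm
  have hWJ := h.sqrtMulResolvent_mul_oneAddInv h0 hd hz
  have hdef := h.holDefect_eq_zero hd hd2 (m := z ^ 2)
    (neg_ne_zero.1 (Complex.slitPlane_ne_zero hz))
  rw [holDefect, if_pos hz, squareDefect] at hdef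
  refine isResolventAt_oneAddComp h.isResolventAt_neg_oneAddInv ?_ ?_ ?_
  · exact (hRJ.smul_left _).add_left (((hRJ.mul_left hTJ).smul_left _).sub_left hTJ)
  · exact (hRT.smul_left _).add_left
      (((hRT.mul_left (Commute.refl _)).smul_left _).sub_left (Commute.refl _))
  · generalize sqrtMulResolvent A d (z ^ 2) = W at *
    generalize resolvent A (z ^ 2) = R at *
    have h1 : W * sqrtRegularized A d = z ^ 2 • (R * oneAddInv A) - oneAddInv A := by
      rw [← sub_eq_zero, ← neg_eq_zero, ← hdef]
      abel
    simp only [add_mul, mul_sub, smul_mul_assoc, mul_smul_comm, hWJ, h1]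
    module

/-- The Cauchy integral `sqrtResolvent` gives the resolvent of `A^{1/2}` in a sector about the
negative axis. -/
theorem SquareResolventBound.isResolventAt_sqrt_neg [CompleteSpace X]
    (h : SquareResolventBound A M)
    (hd : d < Real.pi) (hd2 : Real.pi / 2 < d) {v : ℂ} (hv : |v.im| < d) :
    IsResolventAt (oneAddComp A (sqrtRegularized A d)) (-Complex.exp (v / 2))
      (-(Complex.exp (v / 2))⁻¹ • sqrtResolvent A d v) := by
  have h0 : 0 < d := by linarith [Real.pi_pos]
  have hlog : Complex.log (Complex.exp v) = v := by
    have := abs_lt.1 hv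
    exact Complex.log_exp (by linarith) (by linarith)
  have hne := Complex.exp_ne_zero (v / 2)
  have hdef := h.holDefect_eq_zero hd hd2 (Complex.exp_ne_zero v)
  rw [h.holDefect_eq hd (Complex.exp_ne_zero v) (by rwa [← Complex.log_im, hlog]), hlog,
    sub_eq_zero] at hdef
  refine isResolventAt_oneAddComp h.isResolventAt_neg_oneAddInv ?_ ?_ ?_
  · exact (h.commute_sqrtResolvent h0 hd hv fun _ hz => h.commute_oneAddInv hz).symm.smul_left _
  · exact (h.commute_sqrtResolvent h0 hd hv fun _ hz =>
      (h.commute_resolvent_sqrtRegularized h0 hd hz).symm).symm.smul_left _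
  · rw [mul_add, mul_smul_comm] at hdef
    simp only [mul_sub, smul_mul_assoc, mul_smul_comm]
    refine Eq.trans ?_ hdef
    match_scalars <;> field_simp

theorem neg_sq_mem_slitPlane {z : ℂ} (hz : z.im ≠ 0) : -z ^ 2 ∈ Complex.slitPlane := by
  rw [neg_mem_slitPlane_iff]
  rintro ⟨t, ht, hzt⟩
  have h1 := congrArg Complex.re hzt
  have h2 := congrArg Complex.im hzt
  simp only [sq, Complex.mul_re, Complex.mul_im, Complex.ofReal_re, Complex.ofReal_im] at h1 h2
  have h3 : z.re = 0 := by
    have : z.re * z.im = 0 := by linarith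
    exact (mul_eq_zero.1 this).resolve_right hz
  rw [h3] at h1
  have := mul_self_pos.2 hz
  linarith

theorem SquareResolventBound.exists_norm_resolvent_sqrt_le [CompleteSpace X]
    (h : SquareResolventBound A M)
    (hd : d < Real.pi) (hd2 : Real.pi / 2 < d) :
    ∃ K : ℝ, 0 ≤ K ∧ ∀ z : ℂ, z.im ≠ 0 →
      ‖resolvent (oneAddComp A (sqrtRegularized A d)) z‖ ≤ K / |z.im| := by
  obtain ⟨K, hK, hW⟩ := h.exists_norm_sqrtMulResolvent_le hd hd2
  have hM := h.nonneg
  refine ⟨M + K * (1 + 2 * M), by positivity, fun z hz => ?_⟩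
  have hz0 : z ≠ 0 := by
    rintro rfl
    simp at hz
  have hzn := norm_pos_iff.2 hz0
  have hzi := abs_pos.2 hz
  rw [resolvent_eq (h.isResolventAt_sqrt hd hd2 (neg_sq_mem_slitPlane hz))]
  set u := 2 * Complex.log z with hu
  have hue : Complex.exp u = z ^ 2 := by
    rw [hu, two_mul, Complex.exp_add, Complex.exp_log hz0, sq]
  have hure : u.re / 2 = Real.log ‖z‖ := by simp [hu, Complex.log_re]
  have huim : u.im / 2 = Complex.arg z := by simp [hu, Complex.log_im]
  have hsin : Real.sin (u.im / 2) = z.im / ‖z‖ := by rw [huim, Complex.sin_arg]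
  have h1 := hW u (by rw [hsin]; exact div_ne_zero hz hzn.ne')
  rw [hue, hure, hsin, Real.exp_neg, Real.exp_log hzn, abs_div, abs_norm] at h1
  have h2 := (h z hz).2
  have h3 : |z.im| ≤ ‖z‖ := Complex.abs_im_le_norm z
  calc _ ≤ ‖z‖ * ‖resolvent A (z ^ 2)‖ + ‖sqrtMulResolvent A d (z ^ 2)‖ :=
        (norm_add_le _ _).trans_eq (congrArg (· + _) (norm_smul _ _))
    _ ≤ ‖z‖ * (M / (‖z‖ * |z.im|)) + K * ‖z‖⁻¹ * (1 + 2 * (M / (|z.im| / ‖z‖))) := by gcongr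
    _ = M / |z.im| + K * (‖z‖⁻¹ + 2 * M / |z.im|) := by field_simp
    _ ≤ M / |z.im| + K * (|z.im|⁻¹ + 2 * M / |z.im|) := by gcongr
    _ = _ := by field_simp

/-! ### Sectoriality -/

theorem ofReal_mem_closure_sector_zero {t : ℝ} (ht : 0 ≤ t) : (t : ℂ) ∈ closure (sector 0) := by
  have h1 : (t : ℝ) ∈ closure (Ioi (0 : ℝ)) := by rwa [closure_Ioi]
  refine map_mem_closure Complex.continuous_ofReal h1 fun s hs => ?_
  rw [sector, if_pos rfl]
  exact ⟨s, hs, rfl⟩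

theorem le_abs_arg_of_notMem_closure_sector {z : ℂ} {w : ℝ} (hw : 0 < w)
    (hz : z ∉ closure (sector w)) (hz0 : z ≠ 0) : w ≤ |Complex.arg z| := by
  by_contra! h
  refine hz (subset_closure ?_)
  rw [sector, if_neg hw.ne']
  exact ⟨hz0, h⟩

theorem SquareResolventBound.isSectorial (h : SquareResolventBound A M) : IsSectorial A 0 where
  nonneg := le_rfl
  lt_pi := Real.pi_pos
  spectrum_subset := by
    intro z hz
    obtain ⟨t, ht, rfl⟩ := h.spectrum_subset hz
    exact ofReal_mem_closure_sector_zero ht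
  bound w hw hwpi := by
    refine ⟨M / Real.sin (w / 2), fun z hz => ?_⟩
    rcases eq_or_ne z 0 with rfl | hz0
    · rw [zero_smul, norm_zero]
      exact div_nonneg h.nonneg (sin_half_pos hw (by linarith)).le
    · have h1 := le_abs_arg_of_notMem_closure_sector hw hz hz0
      have h2 := h.norm_expResolvent_le_of_im (u := Complex.log z) hw (by rwa [Complex.log_im])
        (by rw [Complex.log_im]; linarith [Complex.abs_arg_le_pi z])
      rwa [expResolvent, Complex.exp_log hz0] at h2

/-- The sector about the negative axis on which the resolvent of `A^{1/2}` is known from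
`isResolventAt_sqrt_neg`, with the bound for `sqrtResolvent` on `|Im v| ≤ π/2`. -/
theorem exists_neg_exp_half_eq {z : ℂ} (hre : z.re < 0) (him : |z.im| ≤ √2 / 2 * ‖z‖) :
    ∃ v : ℂ, |v.im| ≤ Real.pi / 2 ∧ -Complex.exp (v / 2) = z := by
  have hpi := Real.pi_pos
  have hz0 : -z ≠ 0 := by
    intro h
    rw [neg_eq_zero.1 h] at hre
    simp at hre
  have hn : 0 < ‖z‖ := by simpa using norm_pos_iff.2 hz0
  refine ⟨2 * Complex.log (-z), ?_, ?_⟩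
  · have h1 : |Complex.arg (-z)| ≤ Real.pi / 4 := by
      have h2 : |(-z).im / ‖-z‖| ≤ √2 / 2 := by
        rw [abs_div, abs_norm, norm_neg, Complex.neg_im, abs_neg, div_le_iff₀ hn]
        exact him
      rw [← Real.sin_pi_div_four] at h2
      rw [Complex.arg_of_re_nonneg (by simpa using hre.le), abs_le]
      rw [abs_le] at h2
      constructor
      · rw [Real.le_arcsin_iff_sin_le' ⟨by linarith, by linarith⟩, Real.sin_neg]
        exact h2.1
      · rw [Real.arcsin_le_iff_le_sin' ⟨by linarith, by linarith⟩]
        exact h2.2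
    simp only [Complex.mul_im, Complex.re_ofNat, Complex.im_ofNat, zero_mul, add_zero,
      Complex.log_im, abs_mul, abs_two]
    linarith
  · rw [mul_div_cancel_left₀ _ two_ne_zero, Complex.exp_log hz0, neg_neg]

theorem SquareResolventBound.sqrt_mem_resolventSet [CompleteSpace X]
    (h : SquareResolventBound A M)
    (hd : d < Real.pi) (hd2 : Real.pi / 2 < d) {z : ℂ} (hz : z.im ≠ 0) :
    z ∈ resolventSet (oneAddComp A (sqrtRegularized A d)) :=
  ⟨_, h.isResolventAt_sqrt hd hd2 (neg_sq_mem_slitPlane hz)⟩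

theorem SquareResolventBound.sqrt_isSectorial [CompleteSpace X]
    (h : SquareResolventBound A M)
    (hd : d < Real.pi) (hd2 : Real.pi / 2 < d) :
    IsSectorial (oneAddComp A (sqrtRegularized A d)) 0 where
  nonneg := le_rfl
  lt_pi := Real.pi_pos
  spectrum_subset := by
    intro z hz
    by_cases him : z.im = 0
    · have hzr : z = (z.re : ℂ) := Complex.ext rfl (by simp [him])
      rcases lt_or_ge z.re 0 with hre | hre
      · obtain ⟨v, hv, hvz⟩ := exists_neg_exp_half_eq hre (by rw [him, abs_zero]; positivity)
        have := h.isResolventAt_sqrt_neg hd hd2 (hv.trans_lt hd2)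
        rw [hvz] at this
        exact absurd ⟨_, this⟩ hz
      · rw [hzr]
        exact ofReal_mem_closure_sector_zero hre
    · exact absurd (h.sqrt_mem_resolventSet hd hd2 him) hz
  bound w hw hwpi := by
    have hpi := Real.pi_pos
    have h0 : 0 < d := by linarith
    obtain ⟨K, hK, hb⟩ := h.exists_norm_resolvent_sqrt_le hd hd2
    set p := 2 * ((2 * Real.sin ((d - Real.pi / 2) / 2))⁻¹ * (M / Real.sin (d / 2))) with hp
    have hp0 : 0 ≤ p := by
      have h1 := h.nonneg
      have h3 := sin_half_pos (a := d - Real.pi / 2) (by linarith) (by linarith)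
      have h4 := sin_half_pos (a := d) (by linarith) (by linarith)
      positivity
    have hsw : 0 < Real.sin w := Real.sin_pos_of_pos_of_lt_pi hw hwpi
    have hs2 : 0 < √2 / 2 := by positivity
    -- Away from the real axis, `|Im z| ≥ c |z|`, and the strip estimate suffices.
    have hstrip : ∀ (c : ℝ) (z : ℂ), 0 < c → z ≠ 0 → c * ‖z‖ ≤ |z.im| →
        ‖z • resolvent (oneAddComp A (sqrtRegularized A d)) z‖ ≤ K / c := by
      intro c z hc hz0 hcz
      have hzn := norm_pos_iff.2 hz0
      have him : 0 < |z.im| := (by positivity : 0 < c * ‖z‖).trans_le hcz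
      rw [norm_smul]
      calc _ ≤ ‖z‖ * (K / |z.im|) := by gcongr; exact hb z (abs_pos.1 him)
        _ ≤ ‖z‖ * (K / (c * ‖z‖)) := by gcongr
        _ = K / c := by field_simp
    refine ⟨p + K / Real.sin w + K / (√2 / 2), fun z hz => ?_⟩
    have e1 : 0 ≤ K / Real.sin w := by positivity
    have e2 : 0 ≤ K / (√2 / 2) := by positivity
    rcases eq_or_ne z 0 with rfl | hz0
    · rw [zero_smul, norm_zero]
      positivity
    have harg := le_abs_arg_of_notMem_closure_sector hw hz hz0
    rcases lt_or_ge z.re 0 with hre | hre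
    · rcases le_or_gt |z.im| (√2 / 2 * ‖z‖) with him | him
      · obtain ⟨v, hv, hvz⟩ := exists_neg_exp_half_eq hre him
        have h1 := h.isResolventAt_sqrt_neg hd hd2 (hv.trans_lt hd2)
        have h2 := h.norm_sqrtResolvent_le h0 hd hd2 hv
        rw [hvz] at h1
        rw [resolvent_eq h1, smul_smul, ← hvz, neg_mul_neg,
          mul_inv_cancel₀ (Complex.exp_ne_zero _), one_smul]
        linarith
      · linarith [hstrip _ z hs2 hz0 him.le]
    · have h1 : |Complex.arg z| ≤ Real.pi / 2 := Complex.abs_arg_le_pi_div_two_iff.2 hre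
      have h2 : Real.sin w * ‖z‖ ≤ |z.im| := by
        have h3 : |z.im| = |Real.sin (Complex.arg z)| * ‖z‖ := by
          rw [Complex.sin_arg, abs_div, abs_norm, div_mul_cancel₀ _ (norm_ne_zero_iff.2 hz0)]
        have h4 := sin_half_le_abs (a := 2 * w) (y := 2 * Complex.arg z) (by linarith)
          (by rw [abs_mul, abs_two]; linarith) (by rw [abs_mul, abs_two]; linarith)
        rw [mul_div_cancel_left₀ _ two_ne_zero, mul_div_cancel_left₀ _ two_ne_zero] at h4
        rw [h3]
        gcongr
      linarith [hstrip _ z hsw hz0 h2]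

/-- A resolvent bound `K / |Im z|` off the real axis is the strong strip-type property of
height zero. -/
theorem isStrongStripType_zero {B : X →ₗ.[ℂ] X} {K : ℝ} (hK : 0 ≤ K)
    (hB : ∀ z : ℂ, z.im ≠ 0 → z ∈ resolventSet B ∧ ‖resolvent B z‖ ≤ K / |z.im|) :
    IsStrongStripType B 0 where
  nonneg := le_rfl
  spectrum_subset := by
    intro z hz
    refine subset_closure ?_
    rw [strip, if_pos rfl]
    by_contra him
    exact hz (hB z him).1
  bound w hw := ⟨K / w, fun z hz =>
    (hB z (abs_pos.1 (hw.trans_le hz))).2.trans (div_le_div_of_nonneg_left hK hw hz)⟩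
  strong_bound w hw := ⟨K, fun z hz =>
    (hB z (abs_pos.1 (hw.trans hz))).2.trans
      (div_le_div_of_nonneg_left hK (by linarith) (by linarith))⟩

theorem SquareResolventBound.isSqrt [CompleteSpace X]
    (h : SquareResolventBound A M) (h0 : 0 < d)
    (hd : d < Real.pi) : IsSqrt A (oneAddComp A (sqrtRegularized A d)) := by
  refine ⟨0, h.isSectorial, fun d' h0' hd' => ?_⟩
  rw [sqrtAlong, contourIntegral_eq_sqrtRegularized A h0' hd', h.sqrtRegularized_eq h0 hd h0' hd']

end

end CosineSqrt
end

theorem lemma6p1 {X : Type*} [NormedAddCommGroup X] [NormedSpace ℂ X] [CompleteSpace X] :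
    (∀ (A : X →ₗ.[ℂ] X) (C : ℝ → X →L[ℂ] X) (M : ℝ), 1 ≤ M →
      CosineSqrt.IsCosineFunction C → (∀ t : ℝ, ‖C t‖ ≤ M) → CosineSqrt.IsGenerator C (-A) →
        CosineSqrt.spectrum A ⊆ {z : ℂ | ∃ t : ℝ, 0 ≤ t ∧ z = t} ∧
          CosineSqrt.SquareResolventBound A M) ∧
    (∀ (A : X →ₗ.[ℂ] X) (M : ℝ), CosineSqrt.SquareResolventBound A M →
      CosineSqrt.IsSectorial A 0 ∧
        ∃ B : X →ₗ.[ℂ] X, CosineSqrt.IsSqrt A B ∧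
          CosineSqrt.IsSectorial B 0 ∧
          CosineSqrt.IsStrongStripType B 0 ∧
          ∃ M' : ℝ, 0 ≤ M' ∧ ∀ z : ℂ, z.im ≠ 0 →
            z ∈ CosineSqrt.resolventSet B ∧ ‖CosineSqrt.resolvent B z‖ ≤ M' / |z.im|) := by
  refine ⟨fun A C M hM hC hCM hG => ?_, fun A M h => ?_⟩
  · have h := hC.squareResolventBound hM hCM hG
    exact ⟨h.spectrum_subset, h⟩
  · -- Any contour angle in `(π/2, π)` would do.
    have hd : 3 * Real.pi / 4 < Real.pi := by linarith [Real.pi_pos]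
    have hd2 : Real.pi / 2 < 3 * Real.pi / 4 := by linarith [Real.pi_pos]
    obtain ⟨K, hK, hb⟩ := h.exists_norm_resolvent_sqrt_le hd hd2
    have hB := fun z (hz : z.im ≠ 0) => And.intro (h.sqrt_mem_resolventSet hd hd2 hz) (hb z hz)
    exact ⟨h.isSectorial, _, h.isSqrt (by linarith [Real.pi_pos]) hd, h.sqrt_isSectorial hd hd2,
      CosineSqrt.isStrongStripType_zero hK hB, K, hK, hB⟩
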